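/- Let $\phi^*u(t)=u(-t)$, $Du=u'$, and let $\mathbb R[D,\phi^*]$ be the algebra of operators $\sum_i a_i\phi^*D^i+\sum_j b_jD^j$ (finite sums, real coefficients) under composition, so that $D\phi^*=-\phi^*D$; it contains the algebra $\mathbb R[D]$ of constant-coefficient differential operators. For $u$ defined on $I=[-T,T]$, $(\phi^*D^iu)(t)=u^{(i)}(-t)$. For $n\ge 1$, $W^{n,1}(I)$ denotes the functions $u$ such that $u,\dots,u^{(n-1)}$ exist and are absolutely continuous on $I$. **Theorem.** Let $L=\sum_i a_i\phi^*D^i+\sum_j b_jD^j\in\mathbb R[D,\phi^*]$ and put $$R=\sum_k a_k\phi^*D^k+\sum_l(-1)^{l+1}b_lD^l\in\mathbb R[D,\phi^*].$$ Then $S:=RL\in\mathbb R[D]$. Moreover, let $T>0$, $I=[-T,T]$, $n\ge1$, and suppose that $L$ has order at most $n$ (that is, $a_i=b_i=0$ for $i>n$) and that $S$ has order $2n$ (equivalently, $a_n^2\ne b_n^2$). Let $\alpha_{ij},\beta_{ij}\in\mathbb R$ and $$B_iu=\sum_{j=0}^{n-1}\left(\alpha_{ij}u^{(j)}(-T)+\beta_{ij}u^{(j)}(T)\right),\qquad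 i=1,\dots,n,$$ and suppose that the reduced homogeneous problem $$Su=0 \text{ on } I,\qquad B_iRu=0,\quad B_iu=0,\qquad i=1,\dots,n,$$ has only the trivial solution in $W^{2n,1}(I)$. Then this reduced problem has a unique Green's function $G:I^2\to\mathbb R$, that is, a unique function $G$ such that, with $m=2n$ and $c_m$ the leading coefficient of $S$: 1. $\partial^kG/\partial t^k$ exists and is continuous on $I^2$ for $0\le k\le m-2$; 2. $\partial^{m-1}G/\partial t^{m-1}$ and $\partial^{m}G/\partial t^{m}$ exist and are continuous on $I^2\setminus\{(t,t):t\in I\}$; 3. for every $t\in(-T,T)$ the one-sided limits (in the second variable) $\frac{\partial^{m-1}G}{\partial t^{m-1}}(t,t^-)$ and $\frac{\partial^{m-1}G}{\partial t^{m-1}}(t,t^+)$ exist, and the first minus the second equals $1/c_m$; 4. for every $s\in(-T,T)$, $G(\cdot,s)$ satisfies $Su=0$ on $I\setminus\{s\}$; 5. for every $s\in(-T,T)$, $u=G(\cdot,s)$ satisfies $B_iRu=0$ and $B_iu=0$ for $i=1,\dots,n$. Furthermore, writing $R_\vdash G(t,s):=R(G(\cdot,s))(t)$, for every $h\in L^1(I)$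 and every $t\in I$ the function $s\mapsto R_\vdash G(t,s)h(s)$ is integrable on $I$, and $$u(t)=\int_{-T}^{T}R_\vdash G(t,s)\,h(s)\,ds,\qquad t\in I,$$ is the unique function $u\in W^{n,1}(I)$ such that $Lu(t)=h(t)$ for almost every $t\in I$ and $B_iu=0$ for $i=1,\dots,n$. -/

import Mathlib

open Set Filter Topology MeasureTheory
open scoped Polynomial

namespace ReflectionBVP

noncomputable section

/-- An element `φ* P(D) + Q(D)` of the algebra `ℝ[D, φ*]`, where `φ* u (t) = u (-t)`:
`refl = P` holds the coefficients of the `φ* D ^ i` and `plain = Q` those of the `D ^ j`. -/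
@[ext]
structure ReflOp where
  refl : ℝ[X]
  plain : ℝ[X]

namespace ReflOp

/-- The product (composition) in `ℝ[D, φ*]`. It is determined by `φ* φ* = 1` and `D φ* = - φ* D`,
that is `P(D) φ* = φ* P(-D)`. -/
instance : Mul ReflOp where
  mul A B :=
    { refl := A.refl * B.plain + A.plain.comp (-Polynomial.X) * B.refl
      plain := A.refl.comp (-Polynomial.X) * B.refl + A.plain * B.plain }

/-- The inclusion `ℝ[D] ⊆ ℝ[D, φ*]`. -/
def ofPoly (S : ℝ[X]) : ReflOp where
  refl := 0
  plain := S

end ReflOp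

/-- The differential expression `P(D) u = ∑ k, p_k u^(k)` at `t`, derivatives being taken within
the set `J` (so one-sided at an endpoint of an interval). -/
def diffOp (P : ℝ[X]) (J : Set ℝ) (u : ℝ → ℝ) (t : ℝ) : ℝ :=
  P.sum fun k c => c * iteratedDerivWithin k u J t

/-- The action `L u (t) = ∑ i, a_i u^(i)(-t) + ∑ j, b_j u^(j)(t)` of `L ∈ ℝ[D, φ*]` on functions
on `J`. -/
def ReflOp.act (L : ReflOp) (J : Set ℝ) (u : ℝ → ℝ) (t : ℝ) : ℝ :=
  diffOp L.refl J u (-t) + diffOp L.plain J u t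

/-- `L_⊢ G (t, s) = L (G (·, s)) (t)`. -/
def ReflOp.turnstile (L : ReflOp) (J : Set ℝ) (G : ℝ → ℝ → ℝ) (t s : ℝ) : ℝ :=
  L.act J (fun τ => G τ s) t

/-- The Sobolev space `W^{m,1}([-T, T])`, `m ≥ 1`, in its continuous representatives:
`u, u', …, u^(m-1)` exist and are absolutely continuous on `[-T, T]`. -/
def IsSobolev (T : ℝ) (m : ℕ) (u : ℝ → ℝ) : Prop :=
  ∀ k : ℕ, k < m → ContDiffOn ℝ k u (Icc (-T) T) ∧
    AbsolutelyContinuousOnInterval (iteratedDerivWithin k u (Icc (-T) T)) (-T) T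

/-- The two-point functional
`B_i u = ∑_{j=0}^{n-1} (α_ij u^(j)(-T) + β_ij u^(j)(T))`. -/
def bdry (T : ℝ) {n : ℕ} (α β : Fin n → Fin n → ℝ) (i : Fin n) (u : ℝ → ℝ) : ℝ :=
  ∑ j : Fin n, (α i j * iteratedDerivWithin j u (Icc (-T) T) (-T) +
    β i j * iteratedDerivWithin j u (Icc (-T) T) T)

/-- The boundary conditions of the reduced problem: the functionals `u ↦ B_i (R u)` and `B_i`. -/
def reducedBdry (T : ℝ) {n : ℕ} (α β : Fin n → Fin n → ℝ) (R : ReflOp) :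
    Fin n ⊕ Fin n → (ℝ → ℝ) → ℝ
  | Sum.inl i => fun u => bdry T α β i (R.act (Icc (-T) T) u)
  | Sum.inr i => bdry T α β i

/-- `u ∈ W^{m,1}([-T, T])` solves `L u = h` almost everywhere on `[-T, T]`, with the homogeneous
conditions `C_i u = 0`; here `m` is the order of `L`. -/
structure IsSolution {ι : Type} (T : ℝ) (m : ℕ) (L : ReflOp) (C : ι → (ℝ → ℝ) → ℝ)
    (h u : ℝ → ℝ) : Prop where
  regular : IsSobolev T m u
  equation : ∀ᵐ t ∂(volume.restrict (Icc (-T) T)), L.act (Icc (-T) T) u t = h t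
  conditions : ∀ i, C i u = 0

/-- `G` is a Green's function on `[-T, T]²` of the problem `S u = f`, `C_i u = 0`, where
`S ∈ ℝ[D]` has order `m = S.natDegree`. Only the values of `G` on the square matter. -/
structure IsGreen {ι : Type} (T : ℝ) (S : ℝ[X]) (C : ι → (ℝ → ℝ) → ℝ) (G : ℝ → ℝ → ℝ) :
    Prop where
  /-- `∂^k G / ∂t^k` exists on the square for `k ≤ m - 2` … -/
  exists_low : ∀ k : ℕ, k + 2 ≤ S.natDegree → ∀ s ∈ Icc (-T) T,
    ContDiffOn ℝ k (fun t => G t s) (Icc (-T) T)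
  /-- … and is jointly continuous there. -/
  continuous_low : ∀ k : ℕ, k + 2 ≤ S.natDegree →
    ContinuousOn (fun p : ℝ × ℝ => iteratedDerivWithin k (fun t => G t p.2) (Icc (-T) T) p.1)
      (Icc (-T) T ×ˢ Icc (-T) T)
  /-- `∂^k G / ∂t^k`, `k = m - 1, m`, exists off the diagonal … -/
  exists_high : ∀ s ∈ Icc (-T) T,
    ContDiffOn ℝ S.natDegree (fun t => G t s) (Icc (-T) T \ {s})
  /-- … and is jointly continuous there. -/
  continuous_high : ∀ k : ℕ, k ≤ S.natDegree → S.natDegree ≤ k + 1 →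
    ContinuousOn
      (fun p : ℝ × ℝ => iteratedDerivWithin k (fun t => G t p.2) (Icc (-T) T \ {p.2}) p.1)
      ((Icc (-T) T ×ˢ Icc (-T) T) \ {p | p.1 = p.2})
  /-- The lateral limits of `∂^(m-1) G / ∂t^(m-1)` at `(t, t⁻)` and `(t, t⁺)` exist, and their
  difference is the inverse of the leading coefficient of `S`. -/
  jump : ∀ k : ℕ, k + 1 = S.natDegree → ∀ t ∈ Ioo (-T) T, ∃ below above : ℝ,
    Tendsto (fun s => iteratedDerivWithin k (fun τ => G τ s) (Icc (-T) T \ {s}) t)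
      (𝓝[<] t) (𝓝 below) ∧
    Tendsto (fun s => iteratedDerivWithin k (fun τ => G τ s) (Icc (-T) T \ {s}) t)
      (𝓝[>] t) (𝓝 above) ∧
    below - above = 1 / S.leadingCoeff
  /-- `S (G (·, s)) = 0` on `[-T, T] \ {s}`. -/
  equation : ∀ s ∈ Ioo (-T) T, ∀ t ∈ Icc (-T) T \ {s},
    diffOp S (Icc (-T) T \ {s}) (fun τ => G τ s) t = 0
  /-- `G (·, s)` satisfies the boundary conditions. -/
  conditions : ∀ s ∈ Ioo (-T) T, ∀ i, C i (fun t => G t s) = 0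

end

end ReflectionBVP

/-! ### Formal jets and the action of the operator algebra on them -/

namespace ReflectionBVP

/-! Existence rests on the identity $LR = RL = S$. If $y = \int G(\cdot,s)h(s)\,ds$ solves the
reduced problem $Sy = h$, then $u = Ry$ satisfies $Lu = LRy = h$, and $B_iu = B_iRy = 0$ is one half
of the reduced boundary conditions. Applying $R$ under the integral sign gives $u = \int R_\vdash
G\,h$ (`integral_turnstile`).

Uniqueness does not descend directly from the reduced problem: from $Ld = 0$ and $B_id = 0$ follows
$Sd = 0$, but not $B_iRd = 0$. A dimension count is used instead. Triviality of the reduced problem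
gives solutions $v$ of $Sv = 0$ dual to the $2n$ functionals; applying $R$ to those dual to the
$B_iR$ gives elements of $\ker L$ dual to the $B_i$. So $(B_i)$ maps $\ker L$ onto $\mathbb R^n$. As
data at $0$, the fixed point of the reflection, determine an element of $\ker L$
(`ACJet.eq_zero_of_data`), this kernel has dimension at most $n$, and $(B_i)$ is injective on it
(`eq_zero_of_bdryJet`).

The Green's function is the translated fundamental solution, cut off to $t > s$, minus the
combination of the $v_i$ that restores the boundary conditions (`isGreen_greenJet`). Any other one
consists of two solutions, left and right of $s$, whose difference is fixed by continuity and the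
jump; the boundary conditions determine the rest (`eq_greenJet`).

Functions are replaced by sequences of formal derivatives, so that operator identities are pure
algebra, and regularity matters only when a sequence is compared with actual derivatives. -/

/-- Formal jets: sequences of functions, the `k`-th entry standing for the `k`-th derivative. -/
abbrev Jet : Type := ℕ → ℝ → ℝ

namespace Jet

/-- Formal differentiation of jets. -/
def shift : Module.End ℝ Jet where
  toFun F k t := F (k + 1) t
  map_add' _ _ := rfl
  map_smul' _ _ := rfl

/-- The jet of `t ↦ u (-t)`. -/
def reflect : Module.End ℝ Jet where
  toFun F k t := (-1) ^ k * F k (-t)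
  map_add' F G := by ext k t; simp [mul_add]
  map_smul' c F := by ext k t; simp; ring

@[simp] lemma shift_apply (F : Jet) (k : ℕ) (t : ℝ) : shift F k t = F (k + 1) t := rfl

@[simp] lemma reflect_apply (F : Jet) (k : ℕ) (t : ℝ) :
    reflect F k t = (-1) ^ k * F k (-t) := rfl

lemma shift_pow_apply (i : ℕ) (F : Jet) (k : ℕ) (t : ℝ) :
    (shift ^ i) F k t = F (k + i) t := by
  induction i generalizing k with
  | zero => simp
  | succ i ih => rw [pow_succ', Module.End.mul_apply, shift_apply, ih]; congr 1; omega

lemma aeval_apply (P : ℝ[X]) (F : Jet) (k : ℕ) (t : ℝ) :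
    Polynomial.aeval shift P F k t = P.sum fun i c => c * F (k + i) t := by
  rw [Polynomial.aeval_eq_sum_range, Polynomial.sum_over_range _ (by simp)]
  simp [LinearMap.sum_apply, Finset.sum_apply, shift_pow_apply]

lemma aeval_apply_of_le {P : ℝ[X]} {n : ℕ} (hP : P.natDegree ≤ n) (F : Jet) (k : ℕ) (t : ℝ) :
    Polynomial.aeval shift P F k t = ∑ i ∈ Finset.range (n + 1), P.coeff i * F (k + i) t := by
  rw [aeval_apply, Polynomial.sum_over_range' _ (by simp) _ (Nat.lt_succ_of_le hP)]

lemma reflect_mul_reflect : reflect * reflect = 1 := by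
  ext F k t
  simp [← mul_assoc, ← mul_pow]

lemma aeval_mul_reflect (P : ℝ[X]) :
    Polynomial.aeval shift P * reflect
      = reflect * Polynomial.aeval shift (P.comp (-Polynomial.X)) := by
  have h1 : shift * reflect = reflect * (-shift) := by
    ext F k t
    simp [pow_succ]
  have h2 : ∀ i : ℕ, shift ^ i * reflect = reflect * (-shift) ^ i := by
    intro i
    induction i with
    | zero => simp
    | succ i ih => rw [pow_succ, mul_assoc, h1, ← mul_assoc, ih, mul_assoc, ← pow_succ]
  induction P using Polynomial.induction_on' with
  | add p q hp hq => rw [map_add, add_mul, hp, hq, Polynomial.add_comp, map_add, mul_add]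
  | monomial i c =>
    simp only [Polynomial.aeval_monomial, Polynomial.monomial_comp, map_mul, map_pow, map_neg,
      Polynomial.aeval_X, Polynomial.aeval_C]
    rw [mul_assoc, h2, Algebra.left_comm]

/-- The action of `ℝ[D, φ*]` on jets. -/
noncomputable def op (L : ReflOp) : Module.End ℝ Jet :=
  reflect * Polynomial.aeval shift L.refl + Polynomial.aeval shift L.plain

/-- Only $\varphi^*\varphi^* = 1$ and $P(D)\varphi^* = \varphi^*P(-D)$ enter. Both hold for
arbitrary sequences, so operators can be composed without any differentiability. -/
lemma op_mul (A B : ReflOp) : op (A * B) = op A * op B := by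
  have e1 : (A * B).refl = A.refl * B.plain + A.plain.comp (-Polynomial.X) * B.refl := rfl
  have e2 : (A * B).plain = A.refl.comp (-Polynomial.X) * B.refl + A.plain * B.plain := rfl
  have h1 := aeval_mul_reflect A.plain
  have h2 := aeval_mul_reflect A.refl
  have h3 := reflect_mul_reflect
  simp only [op, e1, e2, map_add, map_mul, mul_add, add_mul]
  rw [mul_assoc reflect _ (reflect * _), ← mul_assoc _ reflect, h2, ← mul_assoc _ reflect, h1,
    mul_assoc reflect (Polynomial.aeval shift (A.refl.comp _)), ← mul_assoc reflect reflect, h3,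
    one_mul]
  simp only [mul_assoc]
  abel

lemma op_ofPoly (S : ℝ[X]) : op (ReflOp.ofPoly S) = Polynomial.aeval shift S := by
  simp [op, ReflOp.ofPoly]

lemma op_apply (L : ReflOp) (F : Jet) (k : ℕ) (t : ℝ) :
    op L F k t = (-1) ^ k * Polynomial.aeval shift L.refl F k (-t)
      + Polynomial.aeval shift L.plain F k t := rfl

/-- The entries of `F` of index `k` and `k + 1` are related as they should at `t`. -/
def DerivAt (I : Set ℝ) (F : Jet) (k : ℕ) (t : ℝ) : Prop :=
  HasDerivWithinAt (F k) (F (k + 1) t) I t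

lemma DerivAt.aeval {I : Set ℝ} {F : Jet} {k n : ℕ} {t : ℝ} {P : ℝ[X]} (hP : P.natDegree ≤ n)
    (h : ∀ i ≤ n, DerivAt I F (k + i) t) : DerivAt I (Polynomial.aeval shift P F) k t := by
  have e : Polynomial.aeval shift P F k
      = fun t => ∑ i ∈ Finset.range (n + 1), P.coeff i * F (k + i) t := by
    ext t; exact aeval_apply_of_le hP F k t
  unfold DerivAt
  rw [e, aeval_apply_of_le hP]
  refine HasDerivWithinAt.fun_sum fun i hi => ?_
  have := h i (by simpa [Nat.lt_succ_iff] using hi)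
  unfold DerivAt at this
  rw [show k + 1 + i = k + i + 1 by omega]
  exact this.const_mul _

lemma DerivAt.reflect {I : Set ℝ} (hI : ∀ t ∈ I, -t ∈ I) {F : Jet} {k : ℕ} {t : ℝ}
    (h : DerivAt I F k (-t)) : DerivAt I (reflect F) k t := by
  have h1 : HasDerivWithinAt (fun x => F k (-x)) (F (k + 1) (-t) * (-1)) I t :=
    HasDerivWithinAt.comp t h (hasDerivWithinAt_neg t I) hI
  have h2 := h1.const_mul ((-1 : ℝ) ^ k)
  have e : Jet.reflect F (k + 1) t = (-1) ^ k * (F (k + 1) (-t) * (-1)) := by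
    rw [reflect_apply, pow_succ]; ring
  unfold DerivAt
  rw [e]
  exact h2

lemma DerivAt.add {I : Set ℝ} {F G : Jet} {k : ℕ} {t : ℝ} (hF : DerivAt I F k t)
    (hG : DerivAt I G k t) : DerivAt I (F + G) k t :=
  HasDerivWithinAt.add hF hG

lemma DerivAt.op {I : Set ℝ} (hI : ∀ t ∈ I, -t ∈ I) {F : Jet} {k n : ℕ} {t : ℝ} {L : ReflOp}
    (h1 : L.refl.natDegree ≤ n) (h2 : L.plain.natDegree ≤ n)
    (h : ∀ i ≤ n, DerivAt I F (k + i) t) (h' : ∀ i ≤ n, DerivAt I F (k + i) (-t)) :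
    DerivAt I (op L F) k t :=
  DerivAt.add (DerivAt.reflect hI (DerivAt.aeval h1 h')) (DerivAt.aeval h2 h)

/-- The bridge from formal to actual derivatives. The open set `U` localizes it: $G(\cdot,s)$ has a
jet to all orders only away from $s$. -/
lemma iteratedDerivWithin_eq {I U : Set ℝ} (hI : UniqueDiffOn ℝ I) (hU : IsOpen U) {N : ℕ}
    {F : Jet} {u : ℝ → ℝ} (hF : ∀ k < N, ∀ t ∈ I ∩ U, DerivAt I F k t)
    (hu : ∀ t ∈ I ∩ U, u t = F 0 t) :
    ∀ k ≤ N, ∀ t ∈ I ∩ U, iteratedDerivWithin k u I t = F k t := by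
  intro k
  induction k with
  | zero => intro _ t ht; simpa using hu t ht
  | succ k ih =>
    intro hk t ht
    rw [iteratedDerivWithin_succ]
    have h1 : iteratedDerivWithin k u I =ᶠ[𝓝[I] t] F k := by
      filter_upwards [inter_mem self_mem_nhdsWithin
        (mem_nhdsWithin_of_mem_nhds (hU.mem_nhds ht.2))] with x hx
      exact ih (by omega) x hx
    rw [h1.derivWithin_eq (ih (by omega) t ht)]
    exact HasDerivWithinAt.derivWithin (hF k (by omega) t ht) (hI t ht.1)

lemma diffOp_eq {P : ℝ[X]} {n : ℕ} (hP : P.natDegree ≤ n) {J : Set ℝ} {u : ℝ → ℝ} {F : Jet}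
    {t : ℝ} (h : ∀ k ≤ n, iteratedDerivWithin k u J t = F k t) :
    diffOp P J u t = Polynomial.aeval shift P F 0 t := by
  rw [aeval_apply, diffOp, Polynomial.sum_over_range' _ (by simp) _ (Nat.lt_succ_of_le hP),
    Polynomial.sum_over_range' _ (by simp) _ (Nat.lt_succ_of_le hP)]
  refine Finset.sum_congr rfl fun i hi => ?_
  rw [h i (by simpa [Nat.lt_succ_iff] using hi), zero_add]

lemma act_eq {L : ReflOp} {n : ℕ} (h1 : L.refl.natDegree ≤ n) (h2 : L.plain.natDegree ≤ n)
    {J : Set ℝ} {u : ℝ → ℝ} {F : Jet} {t : ℝ}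
    (h : ∀ k ≤ n, iteratedDerivWithin k u J t = F k t)
    (h' : ∀ k ≤ n, iteratedDerivWithin k u J (-t) = F k (-t)) :
    L.act J u t = op L F 0 t := by
  rw [ReflOp.act, op_apply, diffOp_eq h1 h', diffOp_eq h2 h]
  simp

lemma contDiffOn {J : Set ℝ} (hJ : UniqueDiffOn ℝ J) {N : ℕ} {F : Jet} {u : ℝ → ℝ}
    (hF : ∀ k < N, ∀ t ∈ J, DerivAt J F k t) (hu : ∀ t ∈ J, u t = F 0 t)
    (hc : ContinuousOn (F N) J) : ContDiffOn ℝ N u J := by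
  have e := iteratedDerivWithin_eq hJ isOpen_univ (N := N) (F := F) (u := u)
    (fun k hk t ht => hF k hk t ht.1) (fun t ht => hu t ht.1)
  rw [contDiffOn_nat_iff_continuousOn_differentiableOn_deriv hJ]
  refine ⟨fun k hk => ?_, fun k hk => ?_⟩
  · refine ContinuousOn.congr (f := F k) ?_ fun t ht => e k hk t ⟨ht, mem_univ t⟩
    rcases hk.lt_or_eq with h | rfl
    · exact fun t ht => (hF k h t ht).continuousWithinAt
    · exact hc
  · refine DifferentiableOn.congr (f := F k) ?_ fun t ht => e k hk.le t ⟨ht, mem_univ t⟩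
    exact fun t ht => (hF k hk t ht).differentiableWithinAt

end Jet

/-! ### Solutions of $Su = 0$ on the line and their expansion in initial data -/

namespace Jet

/-- The jets of the solutions of `S u = 0` on the line. -/
def Sol (S : ℝ[X]) : Submodule ℝ Jet where
  carrier := {F | (∀ k t, HasDerivAt (F k) (F (k + 1) t) t) ∧ Polynomial.aeval shift S F = 0}
  add_mem' := by
    rintro F G ⟨h1, h2⟩ ⟨h3, h4⟩
    exact ⟨fun k t => (h1 k t).add (h3 k t), by rw [map_add, h2, h4, add_zero]⟩
  zero_mem' := ⟨fun k t => hasDerivAt_const t 0, map_zero _⟩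
  smul_mem' := by
    rintro c F ⟨h1, h2⟩
    exact ⟨fun k t => (h1 k t).const_mul c, by rw [map_smul, h2, smul_zero]⟩

/-- The jet of `t ↦ u (t - a)`. -/
def translate (a : ℝ) : Module.End ℝ Jet where
  toFun F k t := F k (t - a)
  map_add' _ _ := rfl
  map_smul' _ _ := rfl

@[simp] lemma translate_apply (a : ℝ) (F : Jet) (k : ℕ) (t : ℝ) :
    translate a F k t = F k (t - a) := rfl

variable {S : ℝ[X]}

lemma Sol.derivAt {F : Jet} (hF : F ∈ Sol S) (I : Set ℝ) (k : ℕ) (t : ℝ) : DerivAt I F k t :=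
  (hF.1 k t).hasDerivWithinAt

lemma Sol.continuous {F : Jet} (hF : F ∈ Sol S) (k : ℕ) : Continuous (F k) :=
  continuous_iff_continuousAt.2 fun t => (hF.1 k t).continuousAt

lemma Sol.aeval_mem {F : Jet} (hF : F ∈ Sol S) (P : ℝ[X]) :
    Polynomial.aeval shift P F ∈ Sol S := by
  refine ⟨fun k t => ?_, ?_⟩
  · have := DerivAt.aeval (P := P) le_rfl fun i _ => Sol.derivAt hF univ (k + i) t
    exact hasDerivWithinAt_univ.1 this
  · rw [← Module.End.mul_apply, ← map_mul, mul_comm, map_mul, Module.End.mul_apply, hF.2, map_zero]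

lemma Sol.translate_mem {F : Jet} (hF : F ∈ Sol S) (a : ℝ) : translate a F ∈ Sol S := by
  refine ⟨fun k t => (hF.1 k (t - a)).comp_sub_const t a, ?_⟩
  ext k t
  have := congrFun (congrFun hF.2 k) (t - a)
  rw [aeval_apply] at this ⊢
  exact this

/-- The solution is read off from $Y(t) = e^{tA}x$ with $A$ the companion matrix of $S$: coordinate
`o` of $A^kY$ is the $k$-th derivative, and the last row of $A$ encodes $Su = 0$. -/
theorem Sol.exists_initial (hS : 0 < S.natDegree) (x : ℕ → ℝ) :
    ∃ F ∈ Sol S, ∀ k < S.natDegree, F k 0 = x k := by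
  set m := S.natDegree with hm
  let o : Fin m := ⟨0, hS⟩
  let A₀ : (Fin m → ℝ) →ₗ[ℝ] (Fin m → ℝ) :=
    { toFun := fun y k => if h : (k : ℕ) + 1 < m then y ⟨k + 1, h⟩ else
        -∑ j : Fin m, S.coeff j / S.leadingCoeff * y j
      map_add' := by
        intro y z; ext k; dsimp only [Pi.add_apply]
        split_ifs
        · rfl
        · simp only [mul_add, Finset.sum_add_distrib]; ring
      map_smul' := by
        intro c y; ext k; dsimp only [Pi.smul_apply, RingHom.id_apply, smul_eq_mul]
        split_ifs
        · rfl
        · rw [mul_neg, Finset.mul_sum]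
          congr 1
          exact Finset.sum_congr rfl fun j _ => by ring }
  let A : (Fin m → ℝ) →L[ℝ] (Fin m → ℝ) := LinearMap.toContinuousLinearMap A₀
  have hA1 : ∀ (y : Fin m → ℝ) (k : ℕ) (h : k + 1 < m), A y ⟨k, by omega⟩ = y ⟨k + 1, h⟩ := by
    intro y k h
    exact dif_pos h
  have hA2 : ∀ (y : Fin m → ℝ), A y ⟨m - 1, by omega⟩
      = -∑ j : Fin m, S.coeff j / S.leadingCoeff * y j := by
    intro y
    exact dif_neg (by simp; omega)
  have hpow : ∀ (k : ℕ) (h : k < m) (y : Fin m → ℝ), (A ^ k) y o = y ⟨k, h⟩ := by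
    intro k
    induction k with
    | zero => intro h y; simp [o]
    | succ k ih =>
      intro h y
      rw [pow_succ, mul_apply_eq_comp, ih (by omega), hA1 y k h]
  have hpowm : ∀ y : Fin m → ℝ, (A ^ m) y o = -∑ j : Fin m, S.coeff j / S.leadingCoeff * y j := by
    intro y
    have : A ^ m = A ^ (m - 1) * A := by rw [← pow_succ]; congr 1; omega
    rw [this, mul_apply_eq_comp, hpow _ (by omega), hA2]
  have hc : S.leadingCoeff ≠ 0 := by
    rw [Polynomial.leadingCoeff_ne_zero]; rintro rfl; simp at hm; omega
  have hzero : ∀ y : Fin m → ℝ, ∑ i ∈ Finset.range (m + 1), S.coeff i * (A ^ i) y o = 0 := by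
    intro y
    rw [Finset.sum_range_succ, hpowm, ← Fin.sum_univ_eq_sum_range (fun i => S.coeff i * (A ^ i) y o)]
    have : S.coeff m = S.leadingCoeff := rfl
    rw [this, mul_neg, Finset.mul_sum, ← sub_eq_add_neg, sub_eq_zero]
    refine Finset.sum_congr rfl fun j _ => ?_
    rw [hpow _ j.2]
    field_simp
  let Y : ℝ → (Fin m → ℝ) := fun t => NormedSpace.exp (t • A) fun k => x k
  have hY : ∀ t, HasDerivAt Y (A (Y t)) t := by
    intro t
    have := (hasDerivAt_exp_smul_const' A t).clm_apply
      (hasDerivAt_const t (fun k : Fin m => x k))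
    simpa using this
  refine ⟨fun k t => (A ^ k) (Y t) o, ⟨fun k t => ?_, ?_⟩, fun k hk => ?_⟩
  · have h1 := ((A ^ k).hasFDerivAt.comp_hasDerivAt t (hY t))
    have h2 := hasDerivAt_pi.1 h1 o
    rw [← mul_apply_eq_comp, ← pow_succ] at h2
    exact h2
  · ext k t
    rw [aeval_apply_of_le le_rfl]
    have := hzero ((A ^ k) (Y t))
    simp only [← mul_apply_eq_comp, ← pow_add] at this
    simp only [add_comm k]
    exact this
  · dsimp only
    rw [hpow k hk]
    simp [Y]

/-- `g` is the jet of the fundamental solution of `S u = 0`: the solution on the line with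
`u^(k)(0) = 0` for `k + 1 < m` and `u^(m-1)(0) = 1 / c_m`. -/
structure IsFundamental (S : ℝ[X]) (g : Jet) : Prop where
  mem : g ∈ Sol S
  low : ∀ k, k + 1 < S.natDegree → g k 0 = 0
  top : ∀ k, k + 1 = S.natDegree → g k 0 = 1 / S.leadingCoeff

lemma exists_isFundamental (hS : 0 < S.natDegree) : ∃ g, IsFundamental S g := by
  obtain ⟨g, hg, h⟩ := Sol.exists_initial hS
    (fun k => if k + 1 = S.natDegree then 1 / S.leadingCoeff else 0)
  refine ⟨g, hg, fun k hk => ?_, fun k hk => ?_⟩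
  · rw [h k (by omega), if_neg (by omega)]
  · rw [h k (by omega), if_pos hk]

/-- The kernels of the Taylor-like expansion of solutions in terms of their initial data. -/
noncomputable def kernel (S : ℝ[X]) (g : Jet) (k : ℕ) : Jet :=
  Polynomial.aeval shift (Polynomial.divX^[k + 1] S) g

lemma kernel_mem {g : Jet} (hg : g ∈ Sol S) (k : ℕ) : kernel S g k ∈ Sol S :=
  Sol.aeval_mem hg _

lemma coeff_iterate_divX (P : ℝ[X]) (k j : ℕ) :
    (Polynomial.divX^[k] P).coeff j = P.coeff (j + k) := by
  induction k generalizing j with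
  | zero => rfl
  | succ k ih => rw [Function.iterate_succ_apply', Polynomial.coeff_divX, ih]; congr 1; omega

/-- Writing a polynomial as $X$ times its `divX` plus its constant term gives the recursion $w_k' =
w_{k-1} - s_kg$ for the kernels $w_k$; for $k = 0$ the term $w_{-1} = Sg$ vanishes. -/
lemma shift_kernel_aux (g : Jet) (k : ℕ) :
    shift (kernel S g k)
      = Polynomial.aeval shift (Polynomial.divX^[k] S) g - S.coeff k • g := by
  have h := Polynomial.divX_mul_X_add (Polynomial.divX^[k] S)
  rw [coeff_iterate_divX, zero_add] at h
  have h2 : kernel S g k = Polynomial.aeval shift (Polynomial.divX^[k] S).divX g := by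
    rw [kernel, Function.iterate_succ_apply']
  conv_rhs => rw [← h]
  rw [h2, map_add, mul_comm, map_mul]
  simp

lemma kernel_succ_deriv (g : Jet) (k : ℕ) (t : ℝ) :
    kernel S g (k + 1) 1 t = kernel S g k 0 t - S.coeff (k + 1) * g 0 t := by
  have := congrFun (congrFun (shift_kernel_aux (S := S) g (k + 1)) 0) t
  exact this

lemma kernel_zero_deriv {g : Jet} (hg : g ∈ Sol S) (t : ℝ) :
    kernel S g 0 1 t = - S.coeff 0 * g 0 t := by
  have := congrFun (congrFun (shift_kernel_aux (S := S) g 0) 0) t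
  rw [Function.iterate_zero_apply, hg.2] at this
  simpa using this

lemma kernel_top (g : Jet) {k : ℕ} (hk : k + 1 = S.natDegree) (t : ℝ) :
    kernel S g k 0 t = S.leadingCoeff * g 0 t := by
  have : Polynomial.divX^[k + 1] S = Polynomial.C S.leadingCoeff := by
    ext j
    rw [coeff_iterate_divX, Polynomial.coeff_C]
    split_ifs with h
    · rw [h, zero_add, hk]; rfl
    · exact Polynomial.coeff_eq_zero_of_natDegree_lt (by omega)
  rw [kernel, this]
  simp

/-- The polynomial defining the kernel has degree at most $m-1-k$, whereas at $0$ only the entry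
$m-1$ of `g` is nonzero among those below $m$. It is reached only for $k = 0$, with coefficient
$c_m\cdot 1/c_m$. -/
lemma kernel_at_zero {g : Jet} (hg : IsFundamental S g) {k : ℕ} (hk : k < S.natDegree) :
    kernel S g k 0 0 = if k = 0 then 1 else 0 := by
  have hd : (Polynomial.divX^[k + 1] S).natDegree ≤ S.natDegree - (k + 1) := by
    rw [Polynomial.natDegree_le_iff_coeff_eq_zero]
    intro j hj
    rw [coeff_iterate_divX]
    exact Polynomial.coeff_eq_zero_of_natDegree_lt (by omega)
  rw [kernel, aeval_apply_of_le hd, Finset.sum_range_succ, Finset.sum_eq_zero, zero_add]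
  · have hc : S.leadingCoeff ≠ 0 := by
      rw [Polynomial.leadingCoeff_ne_zero]; rintro rfl; simp at hk
    split_ifs with h
    · subst h
      rw [hg.top _ (by omega), coeff_iterate_divX,
        show S.natDegree - (0 + 1) + (0 + 1) = S.natDegree by omega]
      exact mul_one_div_cancel hc
    · rw [hg.low _ (by omega), mul_zero]
  · intro i hi
    rw [hg.low _ (by have := Finset.mem_range.1 hi; omega), mul_zero]

/-- A solution on an interval is determined by its data at any point of it. -/
theorem eq_sum_kernel {g : Jet} (hg : IsFundamental S g) (hS : 0 < S.natDegree) {J : Set ℝ}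
    (hJ : Convex ℝ J) {F : Jet} (hF : ∀ k < S.natDegree, ∀ t ∈ J, DerivAt J F k t)
    (hFS : ∀ t ∈ J, Polynomial.aeval shift S F 0 t = 0) {t₀ t : ℝ} (ht₀ : t₀ ∈ J) (ht : t ∈ J) :
    F 0 t = ∑ k ∈ Finset.range S.natDegree, F k t₀ * kernel S g k 0 (t - t₀) := by
  obtain ⟨p, hp⟩ : ∃ p, S.natDegree = p + 1 := ⟨S.natDegree - 1, by omega⟩
  set E : ℝ → ℝ := fun τ => ∑ k ∈ Finset.range S.natDegree, F k τ * kernel S g k 0 (t - τ) with hE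
  have hw : ∀ k τ, HasDerivAt (fun τ => kernel S g k 0 (t - τ)) (-kernel S g k 1 (t - τ)) τ :=
    fun k τ => ((kernel_mem hg.mem k).1 0 (t - τ)).comp_const_sub t τ
  -- By the recursion for the kernels the derivative telescopes to $g(t-\tau)\,(SF)(\tau) = 0$.
  -- Hence $E$ is constant, and its values at $t$ and $t_0$ are the two sides of the claim.
  have hder : ∀ τ ∈ J, HasDerivWithinAt E 0 J τ := by
    intro τ hτ
    have h1 : HasDerivWithinAt E (∑ k ∈ Finset.range S.natDegree,
        (F (k + 1) τ * kernel S g k 0 (t - τ) + F k τ * (-kernel S g k 1 (t - τ)))) J τ :=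
      HasDerivWithinAt.fun_sum fun k hk =>
        HasDerivWithinAt.mul (hF k (Finset.mem_range.1 hk) τ hτ) (hw k τ).hasDerivWithinAt
    convert h1 using 1
    have h2 := hFS τ hτ
    rw [aeval_apply_of_le le_rfl] at h2
    simp only [zero_add] at h2
    rw [Finset.sum_add_distrib, hp, Finset.sum_range_succ, Finset.sum_range_succ' (fun k =>
      F k τ * (-kernel S g k 1 (t - τ))), kernel_zero_deriv hg.mem, kernel_top g hp.symm]
    simp only [kernel_succ_deriv]
    rw [hp, Finset.sum_range_succ, Finset.sum_range_succ', ← hp] at h2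
    have h3 : ∑ k ∈ Finset.range p, F (k + 1) τ *
          -(kernel S g k 0 (t - τ) - S.coeff (k + 1) * g 0 (t - τ))
        = (∑ k ∈ Finset.range p, S.coeff (k + 1) * F (k + 1) τ) * g 0 (t - τ)
          - ∑ k ∈ Finset.range p, F (k + 1) τ * kernel S g k 0 (t - τ) := by
      rw [Finset.sum_mul, ← Finset.sum_sub_distrib]
      exact Finset.sum_congr rfl fun k _ => by ring
    have h4 : S.leadingCoeff = S.coeff S.natDegree := rfl
    rw [h3, h4, ← hp]
    linear_combination (-g 0 (t - τ)) * h2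
  have hconst : E t = E t₀ := by
    have := hJ.norm_image_sub_le_of_norm_hasDerivWithin_le (C := 0) hder (by simp) ht₀ ht
    simpa [sub_eq_zero] using this
  have h5 : E t = F 0 t := by
    simp only [hE, sub_self]
    rw [Finset.sum_eq_single_of_mem 0 (by simpa using hS), kernel_at_zero hg hS, if_pos rfl,
      mul_one]
    intro k hk hk0
    rw [kernel_at_zero hg (Finset.mem_range.1 hk), if_neg hk0, mul_zero]
  rw [← h5, hconst]

lemma Sol.eq_of_zero_eq {F G : Jet} (hF : F ∈ Sol S) (hG : G ∈ Sol S) (h : F 0 = G 0) : F = G := by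
  funext k
  induction k with
  | zero => exact h
  | succ k ih =>
    funext t
    exact (hF.1 k t).unique (ih ▸ hG.1 k t)

theorem Sol.eq_of_data_eq (hS : 0 < S.natDegree) {F G : Jet} (hF : F ∈ Sol S) (hG : G ∈ Sol S)
    (t₀ : ℝ) (h : ∀ k < S.natDegree, F k t₀ = G k t₀) : F = G := by
  obtain ⟨g, hg⟩ := exists_isFundamental hS
  refine Sol.eq_of_zero_eq hF hG (funext fun t => ?_)
  rw [eq_sum_kernel hg hS convex_univ (fun k _ t _ => Sol.derivAt hF univ k t)
      (fun t _ => by rw [hF.2]; rfl) (mem_univ t₀) (mem_univ t),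
    eq_sum_kernel hg hS convex_univ (fun k _ t _ => Sol.derivAt hG univ k t)
      (fun t _ => by rw [hG.2]; rfl) (mem_univ t₀) (mem_univ t)]
  exact Finset.sum_congr rfl fun k hk => by rw [h k (Finset.mem_range.1 hk)]

/-- A solution vanishing on a nondegenerate interval vanishes. -/
theorem Sol.eq_zero_of_Icc (hS : 0 < S.natDegree) {F : Jet} (hF : F ∈ Sol S) {a b : ℝ}
    (hab : a < b) (h : ∀ t ∈ Icc a b, F 0 t = 0) : F = 0 := by
  have h1 : ∀ k, ∀ t ∈ Icc a b, F k t = 0 := by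
    intro k t ht
    rw [← iteratedDerivWithin_eq (uniqueDiffOn_Icc hab) isOpen_univ (N := k)
      (fun k _ t _ => Sol.derivAt hF (Icc a b) k t) (fun t _ => rfl) k le_rfl t ⟨ht, mem_univ t⟩]
    have h2 : EqOn (F 0) (fun _ => 0) (Icc a b) := h
    rw [iteratedDerivWithin_congr h2 ht]
    simp [iteratedDerivWithin_fun_const_zero]
  exact Sol.eq_of_data_eq hS hF (Submodule.zero_mem _) a
    fun k _ => h1 k a (left_mem_Icc.2 hab.le)

/-- The solution space has dimension `m`. -/
theorem Sol.exists_linearEquiv (hS : 0 < S.natDegree) :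
    Nonempty (Sol S ≃ₗ[ℝ] (Fin S.natDegree → ℝ)) := by
  let f : Sol S →ₗ[ℝ] (Fin S.natDegree → ℝ) :=
    { toFun := fun F k => F.1 k 0
      map_add' := fun _ _ => rfl
      map_smul' := fun _ _ => rfl }
  refine ⟨LinearEquiv.ofBijective f ⟨fun F G h => ?_, fun x => ?_⟩⟩
  · exact Subtype.ext (Sol.eq_of_data_eq hS F.2 G.2 0 fun k hk => congrFun h ⟨k, hk⟩)
  · obtain ⟨F, hF, h⟩ := Sol.exists_initial hS
      (fun k => if hk : k < S.natDegree then x ⟨k, hk⟩ else 0)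
    refine ⟨⟨F, hF⟩, funext fun k => ?_⟩
    change F k 0 = x k
    rw [h k k.2, dif_pos k.2]

/-- Linear functionals, as many as the order, without common zero, have a dual basis. -/
theorem Sol.exists_dual_basis (hS : 0 < S.natDegree) {ι : Type*} [Fintype ι] [DecidableEq ι]
    (hι : Fintype.card ι = S.natDegree) (Λ : ι → Jet →ₗ[ℝ] ℝ)
    (h : ∀ F ∈ Sol S, (∀ i, Λ i F = 0) → F = 0) :
    ∃ v : ι → Jet, (∀ i, v i ∈ Sol S) ∧ ∀ i j, Λ i (v j) = if i = j then 1 else 0 := by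
  obtain ⟨e⟩ := Sol.exists_linearEquiv hS
  let f : Sol S →ₗ[ℝ] (ι → ℝ) := LinearMap.pi fun i => Λ i ∘ₗ (Sol S).subtype
  have : FiniteDimensional ℝ (Sol S) := e.symm.finiteDimensional
  have hfin : Module.finrank ℝ (Sol S) = Module.finrank ℝ (ι → ℝ) := by
    rw [e.finrank_eq]; simp [hι]
  have hinj : Function.Injective f := by
    rw [injective_iff_map_eq_zero]
    exact fun F hF => Subtype.ext (h F.1 F.2 fun i => congrFun hF i)
  have hsurj := (LinearMap.injective_iff_surjective_of_finrank_eq_finrank hfin).1 hinj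
  choose v hv using fun j => hsurj (Pi.single j 1)
  refine ⟨fun j => v j, fun j => (v j).2, fun i j => ?_⟩
  have := congrFun (hv j) i
  rw [Pi.single_apply] at this
  exact this

end Jet

/-! ### Absolute continuity and null sets under reflection -/

lemma AbsolutelyContinuousOnInterval.congr {f g : ℝ → ℝ} {a b : ℝ}
    (hf : AbsolutelyContinuousOnInterval f a b) (h : ∀ t ∈ uIcc a b, f t = g t) :
    AbsolutelyContinuousOnInterval g a b := by
  rw [absolutelyContinuousOnInterval_iff] at hf ⊢
  intro ε hε
  obtain ⟨δ, hδ, H⟩ := hf ε hε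
  refine ⟨δ, hδ, fun E hE hlt => ?_⟩
  have h1 := H E hE hlt
  convert h1 using 1
  refine Finset.sum_congr rfl fun i hi => ?_
  have := hE.1 i hi
  rw [h _ this.1, h _ this.2]

lemma neg_mem_Icc_neg {T t : ℝ} (ht : t ∈ Icc (-T) T) : -t ∈ Icc (-T) T :=
  ⟨by linarith [ht.2], by linarith [ht.1]⟩

lemma uIcc_subset_Icc_neg {T s t : ℝ} (hs : s ∈ Icc (-T) T) (ht : t ∈ Icc (-T) T) :
    uIcc s t ⊆ Icc (-T) T :=
  ordConnected_Icc.uIcc_subset hs ht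

/-- The reflected function is a primitive: $f(-t) = f(T) - \int_{-T}^t f'(-s)\,ds$. -/
lemma AbsolutelyContinuousOnInterval.comp_neg {f : ℝ → ℝ} {T : ℝ} (hT : 0 < T)
    (hf : AbsolutelyContinuousOnInterval f (-T) T) :
    AbsolutelyContinuousOnInterval (fun t => f (-t)) (-T) T := by
  have hle : -T ≤ T := by linarith
  have h1 : IntervalIntegrable (fun s => deriv f (-s)) volume (-T) T := by
    have := (IntervalIntegrable.iff_comp_neg (by simp)).1 hf.intervalIntegrable_deriv.symm
    rwa [neg_neg] at this
  have h2 := h1.absolutelyContinuousOnInterval_intervalIntegral (c := -T) (by simp)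
  have h3 : AbsolutelyContinuousOnInterval (fun _ : ℝ => f T) (-T) T :=
    ContDiffOn.absolutelyContinuousOnInterval contDiffOn_const
  refine AbsolutelyContinuousOnInterval.congr (h3.fun_sub h2) fun t ht => ?_
  rw [uIcc_of_le hle] at ht
  have h4 : ∫ s in (-T)..t, deriv f (-s) = f T - f (-t) := by
    rw [intervalIntegral.integral_comp_neg, neg_neg]
    refine (hf.mono ?_).integral_deriv_eq_sub
    rw [uIcc_of_le hle]
    exact uIcc_subset_Icc_neg (neg_mem_Icc_neg ht) (right_mem_Icc.2 hle)
  rw [h4]; ring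

lemma hasDerivAt_comp_neg {f : ℝ → ℝ} {f' t : ℝ} (h : HasDerivAt f f' (-t)) :
    HasDerivAt (fun x => f (-x)) (-f') t := by
  have := HasDerivAt.comp t h (hasDerivAt_neg t)
  rw [mul_neg_one] at this
  exact this

lemma ae_restrict_neg {T : ℝ} {p : ℝ → Prop} (h : ∀ᵐ t ∂(volume.restrict (Icc (-T) T)), p t) :
    ∀ᵐ t ∂(volume.restrict (Icc (-T) T)), p (-t) := by
  rw [ae_restrict_iff' measurableSet_Icc] at h ⊢
  have := (Measure.measurePreserving_neg (volume : Measure ℝ)).quasiMeasurePreserving.ae h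
  filter_upwards [this] with t ht h1
  exact ht (neg_mem_Icc_neg h1)

lemma AbsolutelyContinuousOnInterval.finsetSum {ι : Type*} {f : ι → ℝ → ℝ} {a b : ℝ}
    (s : Finset ι) (hf : ∀ i ∈ s, AbsolutelyContinuousOnInterval (f i) a b) :
    AbsolutelyContinuousOnInterval (fun t => ∑ i ∈ s, f i t) a b := by
  classical
  induction s using Finset.induction_on with
  | empty =>
    simpa using (ContDiffOn.absolutelyContinuousOnInterval contDiffOn_const :
      AbsolutelyContinuousOnInterval (fun _ : ℝ => (0 : ℝ)) a b)
  | insert k s hk ih =>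
    simp only [Finset.sum_insert hk]
    exact (hf k (Finset.mem_insert_self k s)).fun_add
      (ih fun j hj => hf j (Finset.mem_insert_of_mem hj))

lemma ae_restrict_Icc_mem_nhds (a b : ℝ) : ∀ᵐ t ∂(volume.restrict (Icc a b)), Icc a b ∈ 𝓝 t := by
  rw [ae_restrict_iff' measurableSet_Icc]
  have h2 : ∀ᵐ x : ℝ, x ≠ a := by simp [ae_iff, measure_singleton]
  have h3 : ∀ᵐ x : ℝ, x ≠ b := by simp [ae_iff, measure_singleton]
  filter_upwards [h2, h3] with t hl hr hmem
  exact Icc_mem_nhds (lt_of_le_of_ne hmem.1 hl.symm) (lt_of_le_of_ne hmem.2 hr)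

/-! ### Jets of Sobolev functions and the initial value problem for $L$ -/

namespace Jet

/-- The jets of the functions of `W^{n,1}([-T, T])`: the entries of index less than `n` are
absolutely continuous, with the next entry as derivative almost everywhere. -/
def ACJet (T : ℝ) (n : ℕ) : Submodule ℝ Jet where
  carrier := {F | ∀ k < n, AbsolutelyContinuousOnInterval (F k) (-T) T ∧
    ∀ᵐ t ∂(volume.restrict (Icc (-T) T)), HasDerivAt (F k) (F (k + 1) t) t}
  add_mem' := by
    intro F G hF hG k hk
    refine ⟨(hF k hk).1.add (hG k hk).1, ?_⟩
    filter_upwards [(hF k hk).2, (hG k hk).2] with t h1 h2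
    exact h1.add h2
  zero_mem' := fun k _ => ⟨ContDiffOn.absolutelyContinuousOnInterval contDiffOn_const,
    Eventually.of_forall fun t => hasDerivAt_const t 0⟩
  smul_mem' := by
    intro c F hF k hk
    refine ⟨(hF k hk).1.const_mul c, ?_⟩
    filter_upwards [(hF k hk).2] with t h1
    exact h1.const_mul c

variable {S : ℝ[X]} {T : ℝ} {n : ℕ} {F : Jet}

lemma Sol.mem_ACJet (hF : F ∈ Sol S) (T : ℝ) (n : ℕ) : F ∈ ACJet T n := by
  refine fun k _ => ⟨ContDiffOn.absolutelyContinuousOnInterval (ContDiff.contDiffOn ?_),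
    Eventually.of_forall fun t => hF.1 k t⟩
  rw [contDiff_one_iff_deriv]
  refine ⟨fun t => (hF.1 k t).differentiableAt, ?_⟩
  rw [show deriv (F k) = F (k + 1) from funext fun t => (hF.1 k t).deriv]
  exact Sol.continuous hF (k + 1)

lemma ACJet.aeval_mem {P : ℝ[X]} {r : ℕ} (hP : P.natDegree ≤ r) (hF : F ∈ ACJet T (n + r)) :
    Polynomial.aeval shift P F ∈ ACJet T n := by
  rw [Polynomial.aeval_eq_sum_range, LinearMap.sum_apply]
  refine Submodule.sum_mem _ fun i hi => Submodule.smul_mem _ _ fun k hk => ?_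
  have hi' : i ≤ r := by have := Finset.mem_range.1 hi; omega
  have h := hF (k + i) (by omega)
  have e : ∀ k, (shift ^ i) F k = F (k + i) := fun k => funext fun t => shift_pow_apply i F k t
  rw [e, e, show k + 1 + i = k + i + 1 by omega]
  exact h

lemma ACJet.reflect_mem (hT : 0 < T) (hF : F ∈ ACJet T n) : reflect F ∈ ACJet T n := by
  refine fun k hk => ⟨(AbsolutelyContinuousOnInterval.comp_neg hT (hF k hk).1).const_mul _, ?_⟩
  filter_upwards [ae_restrict_neg (hF k hk).2] with t ht
  have h1 : HasDerivAt (fun x => F k (-x)) (-F (k + 1) (-t)) t := hasDerivAt_comp_neg ht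
  have h2 := h1.const_mul ((-1 : ℝ) ^ k)
  have e : reflect F (k + 1) t = (-1) ^ k * (-F (k + 1) (-t)) := by
    rw [reflect_apply, pow_succ]; ring
  rw [e]
  exact h2

lemma ACJet.op_mem (hT : 0 < T) {L : ReflOp} {r : ℕ} (h1 : L.refl.natDegree ≤ r)
    (h2 : L.plain.natDegree ≤ r) (hF : F ∈ ACJet T (n + r)) : op L F ∈ ACJet T n :=
  Submodule.add_mem _ (ACJet.reflect_mem hT (ACJet.aeval_mem h1 hF)) (ACJet.aeval_mem h2 hF)

lemma ACJet.continuousOn (hT : 0 < T) (hF : F ∈ ACJet T n) {k : ℕ} (hk : k < n) :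
    ContinuousOn (F k) (Icc (-T) T) := by
  have := (hF k hk).1.continuousOn
  rwa [uIcc_of_le (by linarith)] at this

lemma ACJet.integral_eq (hT : 0 < T) (hF : F ∈ ACJet T n) {k : ℕ} (hk : k < n) {s t : ℝ}
    (hs : s ∈ Icc (-T) T) (ht : t ∈ Icc (-T) T) : ∫ x in s..t, F (k + 1) x = F k t - F k s := by
  have hsub := uIcc_subset_Icc_neg hs ht
  rw [← ((hF k hk).1.mono (c := s) (d := t)
    (by rwa [uIcc_of_le (by linarith : -T ≤ T)])).integral_deriv_eq_sub]
  refine intervalIntegral.integral_congr_ae ?_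
  have := (hF k hk).2
  rw [ae_restrict_iff' measurableSet_Icc] at this
  filter_upwards [this] with x hx hxs
  exact (hx (hsub (uIoc_subset_uIcc hxs))).deriv.symm

/-- Below the top index the almost everywhere derivative is itself continuous, so the fundamental
theorem of calculus upgrades it to a derivative at every point. Extending it continuously to the
line covers the endpoints. -/
lemma ACJet.derivAt (hT : 0 < T) (hF : F ∈ ACJet T n) {k : ℕ} (hk : k + 1 < n) {t : ℝ}
    (ht : t ∈ Icc (-T) T) : DerivAt (Icc (-T) T) F k t := by
  have hle : -T ≤ T := by linarith
  set φ : ℝ → ℝ := IccExtend hle ((Icc (-T) T).domRestrict (F (k + 1))) with hφ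
  have hc : Continuous φ :=
    (continuousOn_iff_continuous_domRestrict.1 (ACJet.continuousOn hT hF hk)).Icc_extend'
  have he : ∀ x ∈ Icc (-T) T, φ x = F (k + 1) x := fun x hx => by
    rw [hφ, IccExtend_of_mem hle _ hx]; rfl
  have h1 : HasDerivAt (fun x => F k (-T) + ∫ y in (-T)..x, φ y) (φ t) t :=
    (hc.integral_hasStrictDerivAt (-T) t).hasDerivAt.const_add _
  rw [he t ht] at h1
  have key : ∀ x ∈ Icc (-T) T, F k x = F k (-T) + ∫ y in (-T)..x, φ y := by
    intro x hx
    rw [intervalIntegral.integral_congr (g := F (k + 1)),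
      ACJet.integral_eq hT hF (by omega) (left_mem_Icc.2 hle) hx]
    · ring
    · exact fun y hy => he y (uIcc_subset_Icc_neg (left_mem_Icc.2 hle) hx hy)
  exact h1.hasDerivWithinAt.congr key (key t ht)

lemma ACJet.iteratedDerivWithin_eq (hT : 0 < T) (hF : F ∈ ACJet T n) {u : ℝ → ℝ}
    (hu : ∀ t ∈ Icc (-T) T, u t = F 0 t) {k : ℕ} (hk : k < n) {t : ℝ} (ht : t ∈ Icc (-T) T) :
    iteratedDerivWithin k u (Icc (-T) T) t = F k t :=
  Jet.iteratedDerivWithin_eq (uniqueDiffOn_Icc (by linarith)) isOpen_univ (N := k)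
    (fun _ hj _ hx => ACJet.derivAt hT hF (by omega) hx.1) (fun x hx => hu x hx.1) k le_rfl t
    ⟨ht, mem_univ t⟩

lemma ACJet.ae_iteratedDerivWithin_eq (hT : 0 < T) (hF : F ∈ ACJet T n) {u : ℝ → ℝ}
    (hu : ∀ t ∈ Icc (-T) T, u t = F 0 t) :
    ∀ᵐ t ∂(volume.restrict (Icc (-T) T)), ∀ k ≤ n,
      iteratedDerivWithin k u (Icc (-T) T) t = F k t := by
  rcases n with _ | n
  · filter_upwards [ae_restrict_mem measurableSet_Icc] with t ht k hk
    obtain rfl : k = 0 := by omega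
    simpa using hu t ht
  · filter_upwards [ae_restrict_mem measurableSet_Icc, (hF n (by omega)).2] with t ht hd k hk
    rcases hk.lt_or_eq with h | rfl
    · exact ACJet.iteratedDerivWithin_eq hT hF hu h ht
    · have e : EqOn (iteratedDerivWithin n u (Icc (-T) T)) (F n) (Icc (-T) T) :=
        fun x hx => ACJet.iteratedDerivWithin_eq hT hF hu (by omega) hx
      rw [iteratedDerivWithin_succ, derivWithin_congr e (e ht)]
      exact hd.hasDerivWithinAt.derivWithin (uniqueDiffOn_Icc (by linarith) t ht)

lemma ACJet.isSobolev (hT : 0 < T) (hF : F ∈ ACJet T n) {u : ℝ → ℝ}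
    (hu : ∀ t ∈ Icc (-T) T, u t = F 0 t) : IsSobolev T n u := by
  intro k hk
  refine ⟨Jet.contDiffOn (uniqueDiffOn_Icc (by linarith))
    (fun j hj t ht => ACJet.derivAt hT hF (by omega) ht) hu (ACJet.continuousOn hT hF hk), ?_⟩
  refine AbsolutelyContinuousOnInterval.congr (hF k hk).1 fun t ht => ?_
  rw [uIcc_of_le (by linarith)] at ht
  exact (ACJet.iteratedDerivWithin_eq hT hF hu hk ht).symm

lemma _root_.ReflectionBVP.IsSobolev.mem_ACJet (hT : 0 < T) {u : ℝ → ℝ} (h : IsSobolev T n u) :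
    (fun k => iteratedDerivWithin k u (Icc (-T) T)) ∈ ACJet T n := by
  refine fun k hk => ⟨(h k hk).2, ?_⟩
  have h1 := (h k hk).2.ae_differentiableAt
  filter_upwards [ae_restrict_of_ae h1, ae_restrict_Icc_mem_nhds (-T) T] with t ht hn
  rw [uIcc_of_le (by linarith)] at ht
  have := (ht (mem_of_mem_nhds hn)).hasDerivAt
  rw [iteratedDerivWithin_succ, derivWithin_of_mem_nhds hn]
  exact this

/-- A `W^{n,1}` solution of `L u = 0`, `L` being of order `n` and solvable for the highest
derivative, vanishes if its data at `0` do. -/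
theorem ACJet.eq_zero_of_data (hT : 0 < T) {L : ReflOp} (h1 : L.refl.natDegree ≤ n)
    (h2 : L.plain.natDegree ≤ n) (hne : L.plain.coeff n ^ 2 - L.refl.coeff n ^ 2 ≠ 0)
    (hF : F ∈ ACJet T n) (hLF : ∀ᵐ t ∂(volume.restrict (Icc (-T) T)), op L F 0 t = 0)
    (h0 : ∀ k < n, F k 0 = 0) : ∀ k < n, ∀ t ∈ Icc (-T) T, F k t = 0 := by
  set a := L.refl.coeff n
  set b := L.plain.coeff n
  set d := b ^ 2 - a ^ 2 with hd
  have hd0 : 0 < |d| := abs_pos.2 hne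
  set M : ℝ → ℝ := fun t => ∑ k ∈ Finset.range n, (|F k t| + |F k (-t)|) with hM
  have hMneg : ∀ t, M (-t) = M t := fun t => by
    simp only [hM, neg_neg]; exact Finset.sum_congr rfl fun k _ => add_comm _ _
  have hM0 : ∀ t, 0 ≤ M t := fun t => Finset.sum_nonneg fun k _ => by positivity
  have hMle : ∀ t, ∀ k < n, |F k t| ≤ M t := fun t k hk => by
    refine le_trans ?_ (Finset.single_le_sum (f := fun k => |F k t| + |F k (-t)|)
      (fun k _ => by positivity) (Finset.mem_range.2 hk))
    simp
  set l : ℝ → ℝ := fun t => ∑ k ∈ Finset.range n,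
    (L.refl.coeff k * F k (-t) + L.plain.coeff k * F k t) with hl
  have hop : ∀ t, op L F 0 t = a * F n (-t) + b * F n t + l t := by
    intro t
    rw [op_apply, aeval_apply_of_le h1, aeval_apply_of_le h2, Finset.sum_range_succ,
      Finset.sum_range_succ, hl]
    simp only [zero_add, pow_zero, one_mul, Finset.sum_add_distrib]
    ring
  set C₀ := ∑ k ∈ Finset.range n, (|L.refl.coeff k| + |L.plain.coeff k|) with hC₀
  have hC₀0 : 0 ≤ C₀ := Finset.sum_nonneg fun k _ => by positivity
  have hlle : ∀ t, |l t| ≤ C₀ * M t := by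
    intro t
    rw [hC₀, Finset.sum_mul]
    refine (Finset.abs_sum_le_sum_abs _ _).trans (Finset.sum_le_sum fun k hk => ?_)
    refine (abs_add_le _ _).trans ?_
    rw [abs_mul, abs_mul, add_mul]
    have e1 := hMle t k (Finset.mem_range.1 hk)
    have e2 := hMle (-t) k (Finset.mem_range.1 hk)
    rw [hMneg] at e2
    gcongr
  set C₁ := (|a| + |b|) * C₀ / |d| with hC₁
  have hC₁0 : 0 ≤ C₁ := by positivity
  have hFn : ∀ t, op L F 0 t = 0 → op L F 0 (-t) = 0 → |F n t| ≤ C₁ * M t := by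
    intro t e1 e2
    rw [hop] at e1 e2
    rw [neg_neg] at e2
    -- The equation at $t$ and at $-t$ is a $2\times2$ system for $F_n(t), F_n(-t)$ with determinant
    -- $d = b^2 - a^2$; here $F_n(-t)$ is eliminated.
    have e3 : d * F n t = a * l (-t) - b * l t := by rw [hd]; linear_combination b * e1 - a * e2
    have e4 : |d| * |F n t| ≤ (|a| + |b|) * C₀ * M t := by
      rw [← abs_mul, e3]
      refine (abs_sub _ _).trans ?_
      rw [abs_mul, abs_mul]
      have f1 := hlle t
      have f2 := hlle (-t)
      rw [hMneg] at f2
      have f3 := mul_le_mul_of_nonneg_left f1 (abs_nonneg b)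
      have f4 := mul_le_mul_of_nonneg_left f2 (abs_nonneg a)
      linarith
    rw [hC₁, div_mul_eq_mul_div, le_div_iff₀ hd0]
    linarith
  have hFle : ∀ t, op L F 0 t = 0 → op L F 0 (-t) = 0 → ∀ k < n, |F (k + 1) t| ≤ (1 + C₁) * M t := by
    intro t e1 e2 k hk
    rcases (Nat.succ_le_of_lt hk).lt_or_eq with h | h
    · have := hMle t (k + 1) h
      have := mul_nonneg hC₁0 (hM0 t)
      linarith
    · have := hFn t e1 e2
      rw [← h] at this
      have := hM0 t
      simp only [Nat.succ_eq_add_one] at *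
      linarith
  -- The equation couples $t$ with $-t$, so Grönwall's argument is run on an energy symmetric under
  -- reflection.
  set q : ℝ → ℝ := fun t => ∑ k ∈ Finset.range n, (F k t ^ 2 + F k (-t) ^ 2) with hq
  have hq0 : ∀ t, 0 ≤ q t := fun t => Finset.sum_nonneg fun k _ => by positivity
  have hMq : ∀ t, M t ^ 2 ≤ 2 * n * q t := by
    intro t
    have e1 := sq_sum_le_card_mul_sum_sq (s := Finset.range n) (f := fun k => |F k t| + |F k (-t)|)
    rw [Finset.card_range] at e1
    refine e1.trans ?_
    have e2 : ∑ k ∈ Finset.range n, (|F k t| + |F k (-t)|) ^ 2 ≤ 2 * q t := by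
      rw [hq, Finset.mul_sum]
      refine Finset.sum_le_sum fun k _ => ?_
      rw [← sq_abs (F k t), ← sq_abs (F k (-t))]
      nlinarith [sq_nonneg (|F k t| - |F k (-t)|)]
    have := mul_le_mul_of_nonneg_left e2 (Nat.cast_nonneg (α := ℝ) n)
    linarith
  -- This makes $q' \le 2(1+C_1)M^2 \le Kq$ almost everywhere, so $e^{-Kt}q$ does not increase.
  set K := 2 * (1 + C₁) * (2 * n) with hK
  set E : ℝ → ℝ := fun t => Real.exp (-K * t) * q t with hE
  have hqac : AbsolutelyContinuousOnInterval q (-T) T := by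
    refine AbsolutelyContinuousOnInterval.finsetSum _ fun k hk => ?_
    simp only [pow_two]
    have f1 := (hF k (Finset.mem_range.1 hk)).1
    have f2 := AbsolutelyContinuousOnInterval.comp_neg hT f1
    exact (f1.fun_mul f1).fun_add (f2.fun_mul f2)
  have hEac : AbsolutelyContinuousOnInterval E (-T) T := by
    refine AbsolutelyContinuousOnInterval.fun_mul
      (ContDiffOn.absolutelyContinuousOnInterval (ContDiff.contDiffOn ?_)) hqac
    fun_prop
  have hder : ∀ᵐ t ∂(volume.restrict (Icc (-T) T)), ∀ k < n, HasDerivAt (F k) (F (k + 1) t) t := by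
    rw [ae_all_iff]
    intro k
    by_cases hk : k < n
    · filter_upwards [(hF k hk).2] with t ht _ using ht
    · exact Eventually.of_forall fun t h => absurd h hk
  have hEd : ∀ᵐ t ∂(volume.restrict (Icc (-T) T)), deriv E t ≤ 0 := by
    filter_upwards [hder, ae_restrict_neg hder, hLF, ae_restrict_neg hLF] with t d1 d2 o1 o2
    have dq : HasDerivAt q (∑ k ∈ Finset.range n,
        (2 * F k t * F (k + 1) t - 2 * F k (-t) * F (k + 1) (-t))) t := by
      refine HasDerivAt.fun_sum fun k hk => ?_
      have hk' := Finset.mem_range.1 hk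
      have e1 := (d1 k hk').fun_pow 2
      have e2 : HasDerivAt (fun x => F k (-x)) (-F (k + 1) (-t)) t := hasDerivAt_comp_neg (d2 k hk')
      have e3 := e1.fun_add (e2.fun_pow 2)
      convert e3 using 1
      simp
      ring
    have dE := HasDerivAt.mul (HasDerivAt.exp ((hasDerivAt_id t).const_mul (-K))) dq
    have dE' := HasDerivAt.deriv dE
    change deriv E t = _ at dE'
    rw [dE']
    have hb : ∑ k ∈ Finset.range n, (2 * F k t * F (k + 1) t - 2 * F k (-t) * F (k + 1) (-t))
        ≤ K * q t := by
      calc _ ≤ ∑ k ∈ Finset.range n, 2 * ((1 + C₁) * M t) * (|F k t| + |F k (-t)|) := by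
            refine Finset.sum_le_sum fun k hk => ?_
            have hk' := Finset.mem_range.1 hk
            have g1 := hFle t o1 o2 k hk'
            have g2 := hFle (-t) o2 (by rw [neg_neg]; exact o1) k hk'
            rw [hMneg] at g2
            have g3 : F k t * F (k + 1) t ≤ |F k t| * ((1 + C₁) * M t) := by
              refine (le_abs_self _).trans ?_
              rw [abs_mul]
              exact mul_le_mul_of_nonneg_left g1 (abs_nonneg _)
            have g4 : -(F k (-t) * F (k + 1) (-t)) ≤ |F k (-t)| * ((1 + C₁) * M t) := by
              refine (neg_le_abs _).trans ?_
              rw [abs_mul]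
              exact mul_le_mul_of_nonneg_left g2 (abs_nonneg _)
            linarith
        _ = 2 * (1 + C₁) * M t ^ 2 := by rw [← Finset.mul_sum]; ring
        _ ≤ 2 * (1 + C₁) * (2 * n * q t) := by
            refine mul_le_mul_of_nonneg_left (hMq t) (by positivity)
        _ = K * q t := by rw [hK]; ring
    have := Real.exp_pos (-K * t)
    simp only [id_eq, mul_one] at *
    nlinarith
  have hq_nonneg : ∀ t ∈ Icc 0 T, q t = 0 := by
    intro t ht
    have hsub : uIcc 0 t ⊆ uIcc (-T) T := by
      rw [uIcc_of_le ht.1, uIcc_of_le (by linarith)]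
      exact Icc_subset_Icc (by linarith) ht.2
    have e1 := (hEac.mono hsub).integral_deriv_eq_sub
    have e2 : ∫ x in (0 : ℝ)..t, deriv E x ≤ 0 := by
      rw [intervalIntegral.integral_of_le ht.1]
      refine integral_nonpos_of_ae ?_
      refine ae_restrict_of_ae_restrict_of_subset ?_ hEd
      exact fun x hx => ⟨by linarith [hx.1], by linarith [hx.2, ht.2]⟩
    have e3 : q 0 = 0 := by
      rw [hq]
      refine Finset.sum_eq_zero fun k hk => ?_
      rw [neg_zero, h0 k (Finset.mem_range.1 hk)]; simp
    rw [e1] at e2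
    simp only [hE, e3, mul_zero, sub_zero] at e2
    have e4 := Real.exp_pos (-K * t)
    exact le_antisymm (nonpos_of_mul_nonpos_right e2 e4) (hq0 t)
  -- Since $q(t)$ also controls the values at $-t$, the half-interval $[0,T]$ suffices.
  have hall : ∀ t ∈ Icc 0 T, ∀ k < n, F k t = 0 ∧ F k (-t) = 0 := by
    intro t ht k hk
    have e := (Finset.sum_eq_zero_iff_of_nonneg (fun k _ => by positivity)).1 (hq_nonneg t ht) k
      (Finset.mem_range.2 hk)
    constructor <;> nlinarith [sq_nonneg (F k t), sq_nonneg (F k (-t))]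
  intro k hk t ht
  rcases le_total 0 t with h | h
  · exact (hall t ⟨h, ht.2⟩ k hk).1
  · have := (hall (-t) ⟨by linarith, by linarith [ht.1]⟩ k hk).2
    rwa [neg_neg] at this

end Jet

/-! ### Two-point functionals on jets -/

namespace Jet

/-- Evaluation of the `k`-th entry at `t`. -/
def evalAt (k : ℕ) (t : ℝ) : Jet →ₗ[ℝ] ℝ where
  toFun F := F k t
  map_add' _ _ := rfl
  map_smul' _ _ := rfl

@[simp] lemma evalAt_apply (k : ℕ) (t : ℝ) (F : Jet) : evalAt k t F = F k t := rfl

/-- The functionals in the entries of index less than `m` at `-T` and `T`. -/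
def TwoPoint (T : ℝ) (m : ℕ) : Submodule ℝ (Jet →ₗ[ℝ] ℝ) :=
  Submodule.span ℝ {l | ∃ k < m, l = evalAt k (-T) ∨ l = evalAt k T}

variable {T : ℝ} {m n : ℕ}

lemma TwoPoint.evalAt_mem {k : ℕ} (hk : k < m) {t : ℝ} (ht : t = -T ∨ t = T) :
    evalAt k t ∈ TwoPoint T m :=
  Submodule.subset_span ⟨k, hk, by rcases ht with rfl | rfl <;> simp⟩

lemma TwoPoint.exists_coeff {l : Jet →ₗ[ℝ] ℝ} (hl : l ∈ TwoPoint T m) :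
    ∃ A B : ℕ → ℝ, ∀ F : Jet,
      l F = ∑ k ∈ Finset.range m, (A k * F k (-T) + B k * F k T) := by
  induction hl using Submodule.span_induction with
  | mem l h =>
    obtain ⟨k, hk, rfl | rfl⟩ := h
    · refine ⟨Pi.single k 1, 0, fun F => ?_⟩
      simp [Pi.single_apply, hk]
    · refine ⟨0, Pi.single k 1, fun F => ?_⟩
      simp [Pi.single_apply, hk]
  | zero => exact ⟨0, 0, fun F => by simp⟩
  | add l l' _ _ h h' =>
    obtain ⟨A, B, h⟩ := h
    obtain ⟨A', B', h'⟩ := h'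
    refine ⟨A + A', B + B', fun F => ?_⟩
    rw [LinearMap.add_apply, h, h', ← Finset.sum_add_distrib]
    exact Finset.sum_congr rfl fun k _ => by simp only [Pi.add_apply]; ring
  | smul c l _ h =>
    obtain ⟨A, B, h⟩ := h
    refine ⟨c • A, c • B, fun F => ?_⟩
    rw [LinearMap.smul_apply, h, smul_eq_mul, Finset.mul_sum]
    exact Finset.sum_congr rfl fun k _ => by simp only [Pi.smul_apply, smul_eq_mul]; ring

/-- The reflection exchanges $-T$ and $T$, so composing with `R` keeps a two-point functional and
raises its order by at most $n$. -/
lemma TwoPoint.evalAt_comp_op_mem {R : ReflOp} (h1 : R.refl.natDegree ≤ n)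
    (h2 : R.plain.natDegree ≤ n) {k : ℕ} (hk : k + n < m) {t : ℝ} (ht : t = -T ∨ t = T) :
    evalAt k t ∘ₗ op R ∈ TwoPoint T m := by
  have e : evalAt k t ∘ₗ op R = ∑ i ∈ Finset.range (n + 1),
      (((-1) ^ k * R.refl.coeff i) • evalAt (k + i) (-t) + R.plain.coeff i • evalAt (k + i) t) := by
    ext F
    simp only [LinearMap.comp_apply, evalAt_apply, op_apply, LinearMap.sum_apply,
      LinearMap.add_apply, LinearMap.smul_apply, smul_eq_mul, Finset.sum_add_distrib]
    rw [aeval_apply_of_le h1, aeval_apply_of_le h2, Finset.mul_sum]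
    simp only [mul_assoc]
  rw [e]
  refine Submodule.sum_mem _ fun i hi => ?_
  have hi' := Finset.mem_range.1 hi
  refine Submodule.add_mem _ (Submodule.smul_mem _ _ (evalAt_mem (by omega) ?_))
    (Submodule.smul_mem _ _ (evalAt_mem (by omega) ht))
  rcases ht with rfl | rfl
  · simp
  · simp

lemma TwoPoint.congr {l : Jet →ₗ[ℝ] ℝ} (hl : l ∈ TwoPoint T m) {F G : Jet}
    (h : ∀ k < m, F k (-T) = G k (-T) ∧ F k T = G k T) : l F = l G := by
  obtain ⟨A, B, hAB⟩ := TwoPoint.exists_coeff hl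
  rw [hAB, hAB]
  refine Finset.sum_congr rfl fun k hk => ?_
  rw [(h k (Finset.mem_range.1 hk)).1, (h k (Finset.mem_range.1 hk)).2]

lemma TwoPoint.continuous {l : Jet →ₗ[ℝ] ℝ} (hl : l ∈ TwoPoint T m) {F : ℝ → Jet}
    (h : ∀ k, Continuous (fun s => F s k (-T)) ∧ Continuous fun s => F s k T) :
    Continuous fun s => l (F s) := by
  obtain ⟨A, B, hAB⟩ := TwoPoint.exists_coeff hl
  simp only [hAB]
  exact continuous_finsetSum _ fun k _ =>
    ((h k).1.const_mul (A k)).add ((h k).2.const_mul (B k))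

/-- The functionals `C` are given by the functionals `Λ` in the entries of jets: on functions with
a jet, up to the order `m - 1`, near the end points of `[-T, T]`. -/
def Represents {ι : Type} (T : ℝ) (m : ℕ) (C : ι → (ℝ → ℝ) → ℝ) (Λ : ι → Jet →ₗ[ℝ] ℝ) : Prop :=
  ∀ (U : Set ℝ), IsOpen U → (∀ t ∈ U, -t ∈ U) → T ∈ U → ∀ (u : ℝ → ℝ) (F : Jet),
    (∀ k, k + 1 < m → ∀ t ∈ Icc (-T) T ∩ U, DerivAt (Icc (-T) T) F k t) →
    (∀ t ∈ Icc (-T) T ∩ U, u t = F 0 t) → ∀ i, C i u = Λ i F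

/-- The functional `B_i` on jets. -/
def bdryJet (T : ℝ) (α β : Fin n → Fin n → ℝ) (i : Fin n) : Jet →ₗ[ℝ] ℝ :=
  ∑ j : Fin n, (α i j • evalAt j (-T) + β i j • evalAt j T)

/-- The functionals `B_i R` and `B_i` on jets. -/
noncomputable def reducedJet (T : ℝ) (α β : Fin n → Fin n → ℝ) (R : ReflOp) :
    Fin n ⊕ Fin n → (Jet →ₗ[ℝ] ℝ)
  | Sum.inl i => bdryJet T α β i ∘ₗ op R
  | Sum.inr i => bdryJet T α β i

lemma bdry_eq (hT : 0 < T) (α β : Fin n → Fin n → ℝ) :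
    Represents T n (bdry T α β) (bdryJet T α β) := by
  intro U hU hsym hTU u F hF hu i
  have e := iteratedDerivWithin_eq (uniqueDiffOn_Icc (by linarith : -T < T)) hU (N := n - 1)
    (F := F) (u := u) (fun k hk t ht => hF k (by omega) t ht) hu
  rw [bdry, bdryJet, LinearMap.sum_apply]
  refine Finset.sum_congr rfl fun j _ => ?_
  rw [e j (by omega) _ ⟨left_mem_Icc.2 (by linarith), hsym T hTU⟩,
    e j (by omega) _ ⟨right_mem_Icc.2 (by linarith), hTU⟩]
  rfl

lemma represents_reducedBdry (hT : 0 < T) (α β : Fin n → Fin n → ℝ) {R : ReflOp}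
    (h1 : R.refl.natDegree ≤ n) (h2 : R.plain.natDegree ≤ n) :
    Represents T (2 * n) (reducedBdry T α β R) (reducedJet T α β R) := by
  intro U hU hsym hTU u F hF hu i
  rcases i with i | i
  · have hn : 0 < n := i.pos
    have e := iteratedDerivWithin_eq (uniqueDiffOn_Icc (by linarith : -T < T)) hU (N := 2 * n - 1)
      (F := F) (u := u) (fun k hk t ht => hF k (by omega) t ht) hu
    have hneg : ∀ t ∈ Icc (-T) T ∩ U, -t ∈ Icc (-T) T ∩ U := fun t ht =>
      ⟨neg_mem_Icc_neg ht.1, hsym t ht.2⟩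
    exact bdry_eq hT α β U hU hsym hTU _ (op R F)
      (fun k hk t ht => DerivAt.op (fun t => neg_mem_Icc_neg) h1 h2
        (fun j hj => hF (k + j) (by omega) t ht)
        (fun j hj => hF (k + j) (by omega) (-t) (hneg t ht)))
      (fun t ht => act_eq h1 h2 (fun k hk => e k (by omega) t ht)
        fun k hk => e k (by omega) (-t) (hneg t ht)) i
  · exact bdry_eq hT α β U hU hsym hTU u F (fun k hk => hF k (by omega)) hu i

lemma reducedJet_mem (α β : Fin n → Fin n → ℝ) {R : ReflOp}
    (h1 : R.refl.natDegree ≤ n) (h2 : R.plain.natDegree ≤ n) (i : Fin n ⊕ Fin n) :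
    reducedJet T α β R i ∈ TwoPoint T (2 * n) := by
  rcases i with i | i
  · have e : reducedJet T α β R (Sum.inl i) = ∑ j : Fin n,
        (α i j • (evalAt j (-T) ∘ₗ op R) + β i j • (evalAt j T ∘ₗ op R)) := by
      ext F
      simp [reducedJet, bdryJet]
    rw [e]
    exact Submodule.sum_mem _ fun j _ => Submodule.add_mem _
      (Submodule.smul_mem _ _ (TwoPoint.evalAt_comp_op_mem h1 h2 (by omega) (Or.inl rfl)))
      (Submodule.smul_mem _ _ (TwoPoint.evalAt_comp_op_mem h1 h2 (by omega) (Or.inr rfl)))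
  · change (∑ j : Fin n, (α i j • evalAt j (-T) + β i j • evalAt j T)) ∈ TwoPoint T (2 * n)
    exact Submodule.sum_mem _ fun j _ => Submodule.add_mem _
      (Submodule.smul_mem _ _ (TwoPoint.evalAt_mem (by omega) (Or.inl rfl)))
      (Submodule.smul_mem _ _ (TwoPoint.evalAt_mem (by omega) (Or.inr rfl)))

end Jet

/-! ### Construction of the Green's function -/

namespace Jet

/-- The jet of `t ↦ g (t - s)` to the right of `s`, and zero to the left. -/
noncomputable def stepJet (g : Jet) (s : ℝ) : Jet := fun k t => if s < t then g k (t - s) else 0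

/-- The jet of `t ↦ g (t - s)` on the positive half-line, and zero on the negative one. -/
noncomputable def halfJet (g : Jet) (s : ℝ) : Jet := fun k t => if 0 < t then g k (t - s) else 0

/-- The jet, in the first variable, of the Green's function built on the fundamental solution `g`
and on solutions `v i` dual to the functionals `Λ i`. -/
noncomputable def greenJet {ι : Type} [Fintype ι] (g : Jet) (Λ : ι → Jet →ₗ[ℝ] ℝ) (v : ι → Jet)
    (s : ℝ) : Jet :=
  stepJet g s - ∑ i, Λ i (halfJet g s) • v i

variable {S : ℝ[X]} {g : Jet} {s t T : ℝ} {k : ℕ}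

lemma stepJet_of_lt (h : s < t) : stepJet g s k t = g k (t - s) := if_pos h

lemma stepJet_of_le (h : t ≤ s) : stepJet g s k t = 0 := if_neg h.not_gt

lemma stepJet_eq_max (h : g k 0 = 0) : stepJet g s k t = g k (max (t - s) 0) := by
  rcases lt_or_ge s t with h1 | h1
  · rw [stepJet_of_lt h1, max_eq_left (by linarith)]
  · rw [stepJet_of_le h1, max_eq_right (by linarith), h]

lemma stepJet_hasDerivAt_of_ne (hg : g ∈ Sol S) (h : t ≠ s) (k : ℕ) :
    HasDerivAt (stepJet g s k) (stepJet g s (k + 1) t) t := by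
  rcases lt_or_gt_of_ne h with h1 | h1
  · rw [stepJet_of_le h1.le]
    refine (hasDerivAt_const t (0 : ℝ)).congr_of_eventuallyEq ?_
    filter_upwards [Iio_mem_nhds h1] with x hx using stepJet_of_le (le_of_lt hx)
  · rw [stepJet_of_lt h1]
    refine ((hg.1 k (t - s)).comp_sub_const t s).congr_of_eventuallyEq ?_
    filter_upwards [Ioi_mem_nhds h1] with x hx using stepJet_of_lt hx

/-- At $t = s$ both one-sided derivatives are $0$, because $g_k$ and $g_{k+1}$ vanish at $0$. -/
lemma stepJet_hasDerivAt_of_zero (hg : g ∈ Sol S) (h0 : g k 0 = 0) (h1 : g (k + 1) 0 = 0) (t : ℝ) :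
    HasDerivAt (stepJet g s k) (stepJet g s (k + 1) t) t := by
  rcases eq_or_ne t s with rfl | h
  · rw [stepJet_of_le le_rfl, ← hasDerivWithinAt_univ, ← Iic_union_Ici (a := t)]
    refine HasDerivWithinAt.union ?_ ?_
    · exact (hasDerivWithinAt_const t (Iic t) (0 : ℝ)).congr (fun x hx => stepJet_of_le hx)
        (stepJet_of_le le_rfl)
    · have h2 := ((hg.1 k (t - t)).comp_sub_const t t).hasDerivWithinAt (s := Ici t)
      rw [sub_self, h1] at h2
      refine h2.congr (fun x hx => ?_) ?_
      · rw [stepJet_eq_max h0, max_eq_left (sub_nonneg.2 hx)]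
      · rw [stepJet_eq_max h0, max_eq_left (sub_nonneg.2 le_rfl)]
  · exact stepJet_hasDerivAt_of_ne hg h k

lemma aeval_stepJet (hg : g ∈ Sol S) : Polynomial.aeval shift S (stepJet g s) = 0 := by
  ext k t
  rcases lt_or_ge s t with h | h
  · have := congrFun (congrFun hg.2 k) (t - s)
    rw [aeval_apply] at this ⊢
    simp only [stepJet_of_lt h]
    exact this
  · rw [aeval_apply]
    simp [stepJet_of_le h, Polynomial.sum]

variable {ι : Type} [Fintype ι] {Λ : ι → Jet →ₗ[ℝ] ℝ} {v : ι → Jet}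

lemma greenJet_apply : greenJet g Λ v s k t
    = stepJet g s k t - ∑ i, Λ i (halfJet g s) * v i k t := by
  simp [greenJet, Finset.sum_apply]

lemma sum_smul_mem (hv : ∀ i, v i ∈ Sol S) (c : ι → ℝ) : ∑ i, c i • v i ∈ Sol S :=
  Submodule.sum_mem _ fun i _ => Submodule.smul_mem _ _ (hv i)

lemma greenJet_hasDerivAt_of_ne (hg : g ∈ Sol S) (hv : ∀ i, v i ∈ Sol S) (h : t ≠ s) (k : ℕ) :
    HasDerivAt (greenJet g Λ v s k) (greenJet g Λ v s (k + 1) t) t :=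
  (stepJet_hasDerivAt_of_ne hg h k).sub ((sum_smul_mem hv _).1 k t)

lemma greenJet_hasDerivAt_of_zero (hg : g ∈ Sol S) (hv : ∀ i, v i ∈ Sol S) (h0 : g k 0 = 0)
    (h1 : g (k + 1) 0 = 0) (t : ℝ) :
    HasDerivAt (greenJet g Λ v s k) (greenJet g Λ v s (k + 1) t) t :=
  (stepJet_hasDerivAt_of_zero hg h0 h1 t).sub ((sum_smul_mem hv _).1 k t)

lemma aeval_greenJet (hg : g ∈ Sol S) (hv : ∀ i, v i ∈ Sol S) :
    Polynomial.aeval shift S (greenJet g Λ v s) = 0 := by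
  rw [greenJet, map_sub, aeval_stepJet hg, (sum_smul_mem hv _).2, sub_zero]

/-- This is the purpose of `halfJet`. It has the same end values as `stepJet` for $s$ in the open
interval, but the entry $m-1$ of `stepJet` at $T$ jumps when $s = T$. With `halfJet` the
coefficients of the `v i` stay continuous up to the boundary of the square. -/
lemma continuous_halfJet {m : ℕ} (hT : 0 < T) (hg : g ∈ Sol S) {l : Jet →ₗ[ℝ] ℝ}
    (hl : l ∈ TwoPoint T m) : Continuous fun s => l (halfJet g s) := by
  refine TwoPoint.continuous hl fun k => ⟨?_, ?_⟩
  · have : ∀ s, halfJet g s k (-T) = 0 := fun s => if_neg (by linarith)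
    simp only [this]
    exact continuous_const
  · have : ∀ s, halfJet g s k T = g k (T - s) := fun s => if_pos hT
    simp only [this]
    exact (Sol.continuous hg k).comp (by fun_prop)

lemma twoPoint_stepJet {m : ℕ} (hs : s ∈ Ioo (-T) T) {l : Jet →ₗ[ℝ] ℝ} (hl : l ∈ TwoPoint T m) :
    l (stepJet g s) = l (halfJet g s) := by
  have hT : 0 < T := by linarith [hs.1, hs.2]
  refine TwoPoint.congr hl fun k _ => ⟨?_, ?_⟩
  · rw [stepJet_of_le hs.1.le]
    exact (if_neg (by linarith)).symm
  · rw [stepJet_of_lt hs.2]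
    exact (if_pos hT).symm

lemma continuous_sum_green {m : ℕ} (hT : 0 < T) (hg : g ∈ Sol S) (hv : ∀ i, v i ∈ Sol S)
    (hΛ : ∀ i, Λ i ∈ TwoPoint T m) (k : ℕ) :
    Continuous fun p : ℝ × ℝ => ∑ i, Λ i (halfJet g p.2) * v i k p.1 :=
  continuous_finsetSum _ fun i _ => ((continuous_halfJet hT hg (hΛ i)).comp continuous_snd).mul
    ((Sol.continuous (hv i) k).comp continuous_fst)

lemma uniqueDiffOn_Icc_diff (hT : 0 < T) (s : ℝ) : UniqueDiffOn ℝ (Icc (-T) T \ {s}) := by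
  rw [sdiff_eq]
  exact (uniqueDiffOn_Icc (by linarith)).inter isOpen_compl_singleton

/-- The singularity comes from `stepJet` alone: the `v i` are smooth solutions, so they correct the
boundary values without affecting the jump or the equation. -/
theorem isGreen_greenJet [DecidableEq ι] (hT : 0 < T)
    (hg : IsFundamental S g)
    (hΛ : ∀ i, Λ i ∈ TwoPoint T S.natDegree) (hv : ∀ i, v i ∈ Sol S)
    (hΛv : ∀ i j, Λ i (v j) = if i = j then 1 else 0) {C : ι → (ℝ → ℝ) → ℝ}
    (hC : Represents T S.natDegree C Λ) :
    IsGreen T S C fun t s => greenJet g Λ v s 0 t := by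
  have hI : UniqueDiffOn ℝ (Icc (-T) T) := uniqueDiffOn_Icc (by linarith)
  have hcont : ∀ k, k + 1 < S.natDegree →
      Continuous fun p : ℝ × ℝ => greenJet g Λ v p.2 k p.1 := by
    intro k hk
    simp only [greenJet_apply, stepJet_eq_max (hg.low k hk)]
    exact ((Sol.continuous hg.mem k).comp (by fun_prop)).sub (continuous_sum_green hT hg.mem hv hΛ k)
  have hlow : ∀ k, k + 2 < S.natDegree → ∀ s t,
      HasDerivAt (greenJet g Λ v s k) (greenJet g Λ v s (k + 1) t) t := fun k hk s t =>
    greenJet_hasDerivAt_of_zero hg.mem hv (hg.low k (by omega)) (hg.low _ (by omega)) t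
  have hhigh : ∀ k s t, t ≠ s → HasDerivAt (greenJet g Λ v s k) (greenJet g Λ v s (k + 1) t) t :=
    fun k s t h => greenJet_hasDerivAt_of_ne hg.mem hv h k
  have hit : ∀ k s, ∀ t ∈ Icc (-T) T \ {s}, iteratedDerivWithin k
      (fun t => greenJet g Λ v s 0 t) (Icc (-T) T \ {s}) t = greenJet g Λ v s k t := fun k s t ht =>
    iteratedDerivWithin_eq (uniqueDiffOn_Icc_diff hT s) isOpen_univ (N := k)
      (fun j _ t ht => (hhigh j s t ht.1.2).hasDerivWithinAt) (fun t _ => rfl) k le_rfl t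
      ⟨ht, mem_univ t⟩
  refine ⟨?_, ?_, ?_, ?_, ?_, ?_, ?_⟩
  · intro k hk s _
    refine Jet.contDiffOn hI (F := greenJet g Λ v s)
      (fun j hj t _ => (hlow j (by omega) s t).hasDerivWithinAt) (fun t _ => rfl) ?_
    exact ((hcont k (by omega)).comp (continuous_id.prodMk continuous_const)).continuousOn
  · intro k hk
    refine (hcont k (by omega)).continuousOn.congr fun p hp => ?_
    exact iteratedDerivWithin_eq hI isOpen_univ (F := greenJet g Λ v p.2) (N := k)
      (fun j hj t _ => (hlow j (by omega) p.2 t).hasDerivWithinAt) (fun t _ => rfl) k le_rfl p.1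
      ⟨hp.1, mem_univ _⟩
  · intro s _
    exact Jet.contDiffOn (uniqueDiffOn_Icc_diff hT s) (F := greenJet g Λ v s)
      (fun j _ t ht => (hhigh j s t ht.2).hasDerivWithinAt) (fun t _ => rfl)
      fun t ht => (hhigh _ s t ht.2).continuousAt.continuousWithinAt
  · intro k _ _
    refine ContinuousOn.congr (f := fun p : ℝ × ℝ => greenJet g Λ v p.2 k p.1) ?_
      fun p hp => hit k p.2 p.1 ⟨hp.1.1, hp.2⟩
    simp only [greenJet_apply]
    refine ContinuousOn.sub ?_ (continuous_sum_green hT hg.mem hv hΛ k).continuousOn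
    rintro ⟨t, s⟩ ⟨_, hne⟩
    refine ContinuousAt.continuousWithinAt ?_
    rcases lt_or_gt_of_ne (show t ≠ s from hne) with h | h
    · refine (continuousAt_const (y := (0 : ℝ))).congr ?_
      filter_upwards [(isOpen_lt continuous_fst continuous_snd).mem_nhds h] with p hp
      exact (stepJet_of_le (le_of_lt hp)).symm
    · have h1 : Continuous fun p : ℝ × ℝ => g k (p.1 - p.2) :=
        (Sol.continuous hg.mem k).comp (by fun_prop)
      refine h1.continuousAt.congr ?_
      filter_upwards [(isOpen_lt continuous_snd continuous_fst).mem_nhds h] with p hp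
      exact (stepJet_of_lt hp).symm
  · intro k hk t ht
    have hc : Continuous fun s => ∑ i, Λ i (halfJet g s) * v i k t :=
      (continuous_sum_green hT hg.mem hv hΛ k).comp (continuous_const.prodMk continuous_id)
    -- For $s < t$ the step is active and contributes $g_k(t-s) \to 1/c_m$; for $s > t$ it
    -- contributes $0$.
    refine ⟨g k 0 - ∑ i, Λ i (halfJet g t) * v i k t, 0 - ∑ i, Λ i (halfJet g t) * v i k t,
      ?_, ?_, by rw [hg.top k hk]; ring⟩
    · have h1 : Continuous fun s => g k (t - s) := (Sol.continuous hg.mem k).comp (by fun_prop)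
      have h2 : Tendsto (fun s => g k (t - s) - ∑ i, Λ i (halfJet g s) * v i k t) (𝓝[<] t)
          (𝓝 (g k (t - t) - ∑ i, Λ i (halfJet g t) * v i k t)) :=
        ((h1.sub hc).tendsto t).mono_left nhdsWithin_le_nhds
      rw [sub_self] at h2
      refine h2.congr' ?_
      filter_upwards [self_mem_nhdsWithin] with s hs
      have hs' : s < t := hs
      rw [hit k s t ⟨Ioo_subset_Icc_self ht, hs'.ne'⟩, greenJet_apply, stepJet_of_lt hs']
    · have h2 : Tendsto (fun s => 0 - ∑ i, Λ i (halfJet g s) * v i k t) (𝓝[>] t)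
          (𝓝 (0 - ∑ i, Λ i (halfJet g t) * v i k t)) :=
        ((continuous_const.sub hc).tendsto t).mono_left nhdsWithin_le_nhds
      refine h2.congr' ?_
      filter_upwards [self_mem_nhdsWithin] with s hs
      have hs' : t < s := hs
      rw [hit k s t ⟨Ioo_subset_Icc_self ht, hs'.ne⟩, greenJet_apply, stepJet_of_le hs'.le]
  · intro s _ t ht
    rw [diffOp_eq le_rfl (fun k _ => hit k s t ht), aeval_greenJet hg.mem hv]
    rfl
  · intro s hs i
    -- Since `R` reads its argument at $t$ and $-t$, both $s$ and $-s$ are removed, which leaves a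
    -- symmetric neighbourhood of the endpoints.
    have hU : IsOpen ({s, -s}ᶜ : Set ℝ) := (Set.toFinite _).isClosed.isOpen_compl
    rw [hC {s, -s}ᶜ hU ?_ ?_ _ (greenJet g Λ v s) ?_ (fun t _ => rfl) i]
    · rw [greenJet, map_sub, map_sum, twoPoint_stepJet hs (hΛ i)]
      simp [hΛv]
    · intro t ht
      simp only [mem_compl_iff, mem_insert_iff, mem_singleton_iff, not_or] at ht ⊢
      exact ⟨fun h => ht.2 (by linarith), fun h => ht.1 (by linarith)⟩
    · simp only [mem_compl_iff, mem_insert_iff, mem_singleton_iff, not_or]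
      exact ⟨hs.2.ne', fun h => hs.1.ne' (by linarith)⟩
    · intro k _ t ht
      have : t ≠ s := fun h => ht.2 (by simp [h])
      exact (hhigh k s t this).hasDerivWithinAt

end Jet

/-! ### Uniqueness of the Green's function -/

namespace Jet

/-- The solution on the line with the same data at `e` as `G (·, s)`. -/
noncomputable def sideJet (S : ℝ[X]) (g : Jet) (T : ℝ) (G : ℝ → ℝ → ℝ) (e s : ℝ) : Jet :=
  ∑ k ∈ Finset.range S.natDegree,
    iteratedDerivWithin k (fun t => G t s) (Icc (-T) T \ {s}) e • translate e (kernel S g k)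

variable {S : ℝ[X]} {g : Jet} {s t e T : ℝ} {k : ℕ} {G : ℝ → ℝ → ℝ}
  {ι : Type} {C : ι → (ℝ → ℝ) → ℝ}

lemma sideJet_mem (hg : g ∈ Sol S) : sideJet S g T G e s ∈ Sol S :=
  Submodule.sum_mem _ fun k _ => Submodule.smul_mem _ _ (Sol.translate_mem (kernel_mem hg k) e)

lemma sideJet_apply : sideJet S g T G e s k t = ∑ j ∈ Finset.range S.natDegree,
    iteratedDerivWithin j (fun t => G t s) (Icc (-T) T \ {s}) e * kernel S g j k (t - e) := by
  simp [sideJet, Finset.sum_apply]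

/-- On each side of the singularity, a Green's function is a solution on the line. -/
lemma eq_sideJet (hT : 0 < T) (hS : 0 < S.natDegree) (hg : IsFundamental S g)
    (hG : IsGreen T S C G) (hs : s ∈ Ioo (-T) T) {U : Set ℝ} (hU : Convex ℝ U) (hsU : s ∉ U)
    (he : e ∈ Icc (-T) T ∩ U) (ht : t ∈ Icc (-T) T ∩ U) : G t s = sideJet S g T G e s 0 t := by
  have hJ := uniqueDiffOn_Icc_diff hT s
  have hsub : Icc (-T) T ∩ U ⊆ Icc (-T) T \ {s} :=
    fun x hx => ⟨hx.1, fun h => hsU (h ▸ hx.2)⟩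
  have h := eq_sum_kernel (F := fun k => iteratedDerivWithin k (fun t => G t s) (Icc (-T) T \ {s}))
    hg hS ((convex_Icc (-T) T).inter hU) (fun k hk x hx => ?_) (fun x hx => ?_) he ht
  · rw [sideJet_apply]
    simpa using h
  · have h1 := (hG.exists_high s (Ioo_subset_Icc_self hs)).differentiableOn_iteratedDerivWithin
      (m := k) (by exact_mod_cast hk) hJ x (hsub hx)
    have h2 := h1.hasDerivWithinAt
    rw [← iteratedDerivWithin_succ] at h2
    exact h2.mono hsub
  · rw [← diffOp_eq le_rfl (fun k _ => rfl)]
    exact hG.equation s hs x (hsub hx)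

lemma iteratedDerivWithin_eq_sideJet (hT : 0 < T) (hS : 0 < S.natDegree) (hg : IsFundamental S g)
    (hG : IsGreen T S C G) (hs : s ∈ Ioo (-T) T) {U : Set ℝ} (hUo : IsOpen U) (hU : Convex ℝ U)
    (hsU : s ∉ U) (he : e ∈ Icc (-T) T ∩ U) (ht : t ∈ Icc (-T) T ∩ U) (k : ℕ) :
    iteratedDerivWithin k (fun t => G t s) (Icc (-T) T \ {s}) t = sideJet S g T G e s k t ∧
    iteratedDerivWithin k (fun t => G t s) (Icc (-T) T) t = sideJet S g T G e s k t := by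
  refine ⟨iteratedDerivWithin_eq (uniqueDiffOn_Icc_diff hT s) hUo (N := k)
      (fun j _ x _ => Sol.derivAt (sideJet_mem hg.mem) _ j x)
      (fun x hx => eq_sideJet hT hS hg hG hs hU hsU he ⟨hx.1.1, hx.2⟩) k le_rfl t
      ⟨⟨ht.1, fun h => hsU (h ▸ ht.2)⟩, ht.2⟩,
    iteratedDerivWithin_eq (uniqueDiffOn_Icc (by linarith)) hUo (N := k)
      (fun j _ x _ => Sol.derivAt (sideJet_mem hg.mem) _ j x)
      (fun x hx => eq_sideJet hT hS hg hG hs hU hsU he hx) k le_rfl t ht⟩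

/-- The jump condition takes limits in $s$ with $t$ fixed, whereas the matching of the two branches
concerns a fixed $s$. Continuity of the branches in $s$ links the two. -/
lemma continuousOn_sideJet (hT : 0 < T) (hS : 0 < S.natDegree) (hg : IsFundamental S g)
    (hG : IsGreen T S C G) {U : ℝ → Set ℝ} (hUo : ∀ s, IsOpen (U s)) (hU : ∀ s, Convex ℝ (U s))
    (hsU : ∀ s, s ∉ U s) (he : e ∈ Icc (-T) T) (heU : ∀ s ∈ Ioo (-T) T, e ∈ U s) (k : ℕ) (t : ℝ) :
    ContinuousOn (fun s => sideJet S g T G e s k t) (Ioo (-T) T) := by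
  simp only [sideJet_apply]
  refine continuousOn_finsetSum _ fun j hj => ContinuousOn.mul ?_ continuousOn_const
  have hj := Finset.mem_range.1 hj
  have hpair : ContinuousOn (fun s : ℝ => (e, s)) (Ioo (-T) T) := by fun_prop
  -- Off-diagonal continuity is assumed only for the orders $m-1$ and $m$. Lower orders use
  -- derivatives within the whole interval, which agree with the punctured ones at the endpoint.
  by_cases h : j + 2 ≤ S.natDegree
  · refine ((hG.continuous_low j h).comp hpair
      fun s hs => ⟨he, Ioo_subset_Icc_self hs⟩).congr fun s hs => ?_
    have := iteratedDerivWithin_eq_sideJet hT hS hg hG hs (hUo s) (hU s) (hsU s) ⟨he, heU s hs⟩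
      ⟨he, heU s hs⟩ j
    exact this.1.trans this.2.symm
  · exact (hG.continuous_high j hj.le (by omega)).comp hpair fun s hs =>
      ⟨⟨he, Ioo_subset_Icc_self hs⟩, fun h : e = s => hsU s (h ▸ heU s hs)⟩

/-- The two branches of a Green's function differ by the translated fundamental solution. -/
lemma sideJet_right_eq (hT : 0 < T) (hS : 2 ≤ S.natDegree) (hg : IsFundamental S g)
    (hG : IsGreen T S C G) (hs : s ∈ Ioo (-T) T) :
    sideJet S g T G T s = sideJet S g T G (-T) s + translate s g := by
  have hS0 : 0 < S.natDegree := by omega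
  have hTI : T ∈ Icc (-T) T := right_mem_Icc.2 (by linarith)
  have hTI' : -T ∈ Icc (-T) T := left_mem_Icc.2 (by linarith)
  have hr := fun (s : ℝ) (hs : s ∈ Ioo (-T) T) (t : ℝ) (ht : t ∈ Icc (-T) T ∩ Ioi s) =>
    iteratedDerivWithin_eq_sideJet hT hS0 hg hG hs isOpen_Ioi (convex_Ioi s) self_notMem_Ioi
      ⟨hTI, hs.2⟩ ht
  have hl := fun (s : ℝ) (hs : s ∈ Ioo (-T) T) (t : ℝ) (ht : t ∈ Icc (-T) T ∩ Iio s) =>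
    iteratedDerivWithin_eq_sideJet hT hS0 hg hG hs isOpen_Iio (convex_Iio s) self_notMem_Iio
      ⟨hTI', hs.1⟩ ht
  have hmr := sideJet_mem (T := T) (G := G) (e := T) (s := s) hg.mem
  have hml := sideJet_mem (T := T) (G := G) (e := -T) (s := s) hg.mem
  refine Sol.eq_of_data_eq hS0 hmr (Submodule.add_mem _ hml (Sol.translate_mem hg.mem s)) s
    fun k hk => ?_
  change _ = sideJet S g T G (-T) s k s + g k (s - s)
  rw [sub_self]
  have hIr : Icc (-T) T ∈ 𝓝[>] s := mem_nhdsWithin_of_mem_nhds (Icc_mem_nhds hs.1 hs.2)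
  have hIl : Icc (-T) T ∈ 𝓝[<] s := mem_nhdsWithin_of_mem_nhds (Icc_mem_nhds hs.1 hs.2)
  by_cases h : k + 2 ≤ S.natDegree
  · rw [hg.low k (by omega), add_zero]
    have hc : ContinuousAt (iteratedDerivWithin k (fun t => G t s) (Icc (-T) T)) s := by
      refine ContinuousOn.continuousAt (s := Icc (-T) T) ?_ (Icc_mem_nhds hs.1 hs.2)
      exact (hG.continuous_low k h).comp (f := fun t : ℝ => (t, s)) (by fun_prop)
        fun t ht => ⟨ht, Ioo_subset_Icc_self hs⟩
    have e1 : iteratedDerivWithin k (fun t => G t s) (Icc (-T) T) s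
        = sideJet S g T G T s k s := by
      refine tendsto_nhds_unique (hc.tendsto.mono_left (nhdsWithin_le_nhds (s := Ioi s))) ?_
      refine (((Sol.continuous hmr k).tendsto s).mono_left nhdsWithin_le_nhds).congr' ?_
      filter_upwards [hIr, self_mem_nhdsWithin] with t ht ht'
      exact (hr s hs t ⟨ht, ht'⟩ k).2.symm
    have e2 : iteratedDerivWithin k (fun t => G t s) (Icc (-T) T) s
        = sideJet S g T G (-T) s k s := by
      refine tendsto_nhds_unique (hc.tendsto.mono_left (nhdsWithin_le_nhds (s := Iio s))) ?_
      refine (((Sol.continuous hml k).tendsto s).mono_left nhdsWithin_le_nhds).congr' ?_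
      filter_upwards [hIl, self_mem_nhdsWithin] with t ht ht'
      exact (hl s hs t ⟨ht, ht'⟩ k).2.symm
    exact e1.symm.trans e2
  -- Here $k = m-1$. At the fixed point $s$, a singularity $\sigma < s$ puts $s$ on the right branch
  -- of $G(\cdot,\sigma)$, so `below` belongs to the data at $T$ and `above` to those at $-T$.
  · obtain ⟨below, above, hb, ha, hj⟩ := hG.jump k (by omega) s hs
    have hcr : ContinuousAt (fun σ => sideJet S g T G T σ k s) s :=
      (continuousOn_sideJet hT hS0 hg hG (fun _ => isOpen_Ioi) (fun σ => convex_Ioi σ)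
        (fun _ => self_notMem_Ioi) hTI (fun σ hσ => hσ.2) k s).continuousAt
        (Ioo_mem_nhds hs.1 hs.2)
    have hcl : ContinuousAt (fun σ => sideJet S g T G (-T) σ k s) s :=
      (continuousOn_sideJet hT hS0 hg hG (fun _ => isOpen_Iio) (fun σ => convex_Iio σ)
        (fun _ => self_notMem_Iio) hTI' (fun σ hσ => hσ.1) k s).continuousAt
        (Ioo_mem_nhds hs.1 hs.2)
    have e1 : below = sideJet S g T G T s k s := by
      refine tendsto_nhds_unique hb ((hcr.tendsto.mono_left nhdsWithin_le_nhds).congr' ?_)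
      filter_upwards [mem_nhdsWithin_of_mem_nhds (Ioo_mem_nhds hs.1 hs.2),
        self_mem_nhdsWithin] with σ hσ hσ'
      exact (hr σ hσ s ⟨Ioo_subset_Icc_self hs, hσ'⟩ k).1.symm
    have e2 : above = sideJet S g T G (-T) s k s := by
      refine tendsto_nhds_unique ha ((hcl.tendsto.mono_left nhdsWithin_le_nhds).congr' ?_)
      filter_upwards [mem_nhdsWithin_of_mem_nhds (Ioo_mem_nhds hs.1 hs.2),
        self_mem_nhdsWithin] with σ hσ hσ'
      exact (hl σ hσ s ⟨Ioo_subset_Icc_self hs, hσ'⟩ k).1.symm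
    rw [hg.top k (by omega), ← e1, ← e2, ← hj]
    ring

variable [Fintype ι] [DecidableEq ι] {Λ : ι → Jet →ₗ[ℝ] ℝ} {v : ι → Jet}

lemma eq_greenJet_of_ne (hT : 0 < T) (hS : 2 ≤ S.natDegree) (hg : IsFundamental S g)
    (hΛ : ∀ i, Λ i ∈ TwoPoint T S.natDegree) (hv : ∀ i, v i ∈ Sol S)
    (hΛv : ∀ i j, Λ i (v j) = if i = j then 1 else 0)
    (htriv : ∀ F ∈ Sol S, (∀ i, Λ i F = 0) → F = 0)
    (hC : Represents T S.natDegree C Λ) (hG : IsGreen T S C G) (hs : s ∈ Ioo (-T) T)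
    (ht : t ∈ Icc (-T) T) (hts : t ≠ s) : G t s = greenJet g Λ v s 0 t := by
  have hS0 : 0 < S.natDegree := by omega
  set N := sideJet S g T G (-T) s with hN
  have hNm : N ∈ Sol S := sideJet_mem hg.mem
  have key : ∀ x ∈ Icc (-T) T, x ≠ s → G x s = (stepJet g s + N) 0 x := by
    intro x hx hxs
    rcases lt_or_gt_of_ne hxs with h | h
    · rw [eq_sideJet hT hS0 hg hG hs (convex_Iio s) self_notMem_Iio
        ⟨left_mem_Icc.2 (by linarith), hs.1⟩ ⟨hx, h⟩]
      change _ = stepJet g s 0 x + N 0 x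
      rw [stepJet_of_le h.le, zero_add]
    · rw [eq_sideJet hT hS0 hg hG hs (convex_Ioi s) self_notMem_Ioi
        ⟨right_mem_Icc.2 (by linarith), hs.2⟩ ⟨hx, h⟩, sideJet_right_eq hT hS hg hG hs]
      change N 0 x + g 0 (x - s) = stepJet g s 0 x + N 0 x
      rw [stepJet_of_lt h, add_comm]
  have hcond : ∀ i, Λ i (halfJet g s) + Λ i N = 0 := by
    intro i
    have hU : IsOpen ({s, -s}ᶜ : Set ℝ) := (Set.toFinite _).isClosed.isOpen_compl
    rw [← twoPoint_stepJet hs (hΛ i), ← map_add, ← hG.conditions s hs i]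
    symm
    refine hC {s, -s}ᶜ hU ?_ ?_ _ _ ?_ ?_ i
    · intro t ht
      simp only [mem_compl_iff, mem_insert_iff, mem_singleton_iff, not_or] at ht ⊢
      exact ⟨fun h => ht.2 (by linarith), fun h => ht.1 (by linarith)⟩
    · simp only [mem_compl_iff, mem_insert_iff, mem_singleton_iff, not_or]
      exact ⟨hs.2.ne', fun h => hs.1.ne' (by linarith)⟩
    · intro k _ t ht
      have hts : t ≠ s := fun h => ht.2 (by simp [h])
      exact DerivAt.add (stepJet_hasDerivAt_of_ne hg.mem hts k).hasDerivWithinAt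
        (Sol.derivAt hNm _ k t)
    · exact fun t ht => key t ht.1 fun h => ht.2 (by simp [h])
  -- The regular part `N` and $-\sum_i \Lambda_i(\text{halfJet})\,v_i$ are solutions with the same
  -- boundary values, so triviality identifies them.
  have hzero : N + ∑ i, Λ i (halfJet g s) • v i = 0 := by
    refine htriv _ (Submodule.add_mem _ hNm (sum_smul_mem hv _)) fun i => ?_
    rw [map_add, map_sum, ← hcond i, add_comm]
    simp [hΛv]
  rw [key t ht hts, greenJet, eq_neg_of_add_eq_zero_left hzero, sub_eq_add_neg]

/-- Uniqueness of the Green's function. -/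
theorem eq_greenJet (hT : 0 < T) (hS : 2 ≤ S.natDegree) (hg : IsFundamental S g)
    (hΛ : ∀ i, Λ i ∈ TwoPoint T S.natDegree) (hv : ∀ i, v i ∈ Sol S)
    (hΛv : ∀ i j, Λ i (v j) = if i = j then 1 else 0)
    (htriv : ∀ F ∈ Sol S, (∀ i, Λ i F = 0) → F = 0)
    (hC : Represents T S.natDegree C Λ) (hG : IsGreen T S C G) (ht : t ∈ Icc (-T) T)
    (hs : s ∈ Icc (-T) T) : G t s = greenJet g Λ v s 0 t := by
  have hT' : -T < T := by linarith
  have c1 : ContinuousOn (fun p : ℝ × ℝ => G p.1 p.2) (Icc (-T) T ×ˢ Icc (-T) T) := by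
    simpa using hG.continuous_low 0 hS
  have c2 : ContinuousOn (fun p : ℝ × ℝ => greenJet g Λ v p.2 0 p.1)
      (Icc (-T) T ×ˢ Icc (-T) T) := by
    simpa using (isGreen_greenJet hT hg hΛ hv hΛv hC).continuous_low 0 hS
  -- Density and continuity in $t$ recover the diagonal and the endpoints; continuity in the second
  -- variable then recovers $s = \pm T$.
  have step : ∀ σ ∈ Ioo (-T) T, G t σ = greenJet g Λ v σ 0 t := by
    intro σ hσ
    have hσ' := Ioo_subset_Icc_self hσ
    have heq : EqOn (fun t => G t σ) (fun t => greenJet g Λ v σ 0 t) (Ioo (-T) T ∩ {σ}ᶜ) :=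
      fun x hx => eq_greenJet_of_ne hT hS hg hΛ hv hΛv htriv hC hG hσ (Ioo_subset_Icc_self hx.1) hx.2
    refine heq.of_subset_closure (t := Icc (-T) T)
      (c1.comp (f := fun t : ℝ => (t, σ)) (by fun_prop) fun x hx => ⟨hx, hσ'⟩)
      (c2.comp (f := fun t : ℝ => (t, σ)) (by fun_prop) fun x hx => ⟨hx, hσ'⟩)
      (inter_subset_left.trans Ioo_subset_Icc_self) ?_ ht
    rw [← closure_Ioo hT'.ne]
    exact closure_minimal ((dense_compl_singleton σ).open_subset_closure_inter isOpen_Ioo)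
      isClosed_closure
  have heq : EqOn (fun σ => G t σ) (fun σ => greenJet g Λ v σ 0 t) (Ioo (-T) T) := step
  exact heq.of_subset_closure (t := Icc (-T) T)
    (c1.comp (f := fun σ : ℝ => (t, σ)) (by fun_prop) fun x hx => ⟨ht, hx⟩)
    (c2.comp (f := fun σ : ℝ => (t, σ)) (by fun_prop) fun x hx => ⟨ht, hx⟩)
    Ioo_subset_Icc_self (closure_Ioo hT'.ne).ge hs

end Jet

/-! ### Integration against the Green's function -/

namespace Jet

/-- The jet of `t ↦ ∫ s in -T..t, g (t - s) h s`, the solution of `S u = h` with vanishing data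
at `-T`. -/
noncomputable def duhamelJet (S : ℝ[X]) (g : Jet) (T : ℝ) (h : ℝ → ℝ) : Jet := fun k t =>
  (∫ s in (-T)..t, g k (t - s) * h s) + if k = S.natDegree then h t / S.leadingCoeff else 0

/-- The jet of `t ↦ ∫ s in -T..T, G t s * h s`, `G` being the Green's function. -/
noncomputable def greenSolJet {ι : Type} [Fintype ι] (S : ℝ[X]) (g : Jet) (Λ : ι → Jet →ₗ[ℝ] ℝ)
    (v : ι → Jet) (T : ℝ) (h : ℝ → ℝ) : Jet :=
  duhamelJet S g T h - ∑ i, (∫ s in (-T)..T, Λ i (halfJet g s) * h s) • v i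

variable {S : ℝ[X]} {g : Jet} {s t T : ℝ} {k : ℕ} {h : ℝ → ℝ}

lemma intervalIntegrable_mul (hh : IntegrableOn h (Icc (-T) T)) {f : ℝ → ℝ} (hf : Continuous f)
    {a b : ℝ} (ha : a ∈ Icc (-T) T) (hb : b ∈ Icc (-T) T) :
    IntervalIntegrable (fun s => f s * h s) volume a b := by
  have h1 : IntervalIntegrable h volume a b :=
    (hh.mono_set (uIcc_subset_Icc_neg ha hb)).intervalIntegrable
  exact h1.continuousOn_mul hf.continuousOn

lemma continuous_comp_const_sub (hg : g ∈ Sol S) (k : ℕ) (t : ℝ) :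
    Continuous fun s => g k (t - s) :=
  (Sol.continuous hg k).comp (by fun_prop)

/-- The translates of the fundamental solution, with separated variables. -/
lemma apply_sub_eq_sum (hS : 0 < S.natDegree) (hg : IsFundamental S g) (k : ℕ) (s t : ℝ) :
    g k (t - s) = ∑ j ∈ Finset.range S.natDegree, kernel S g j k t * g j (0 - s) := by
  have hm := Sol.translate_mem hg.mem s
  have e : translate s g = ∑ j ∈ Finset.range S.natDegree, g j (0 - s) • kernel S g j := by
    refine Sol.eq_of_zero_eq hm (Submodule.sum_mem _ fun j _ =>
      Submodule.smul_mem _ _ (kernel_mem hg.mem j)) (funext fun x => ?_)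
    rw [eq_sum_kernel hg hS convex_univ (fun k _ t _ => Sol.derivAt hm univ k t)
      (fun t _ => by rw [hm.2]; rfl) (mem_univ 0) (mem_univ x)]
    simp [Finset.sum_apply]
  have := congrFun (congrFun e k) t
  rw [translate_apply] at this
  rw [this]
  simp only [Finset.sum_apply, Pi.smul_apply, smul_eq_mul, mul_comm]

/-- For $h$ merely integrable, `apply_sub_eq_sum` separates variables and makes the integral a
finite sum of smooth functions times primitives. Differentiation adds the boundary term
$g_k(0)h(t)$, which is $0$ for $k < m-1$ and $h(t)/c_m$ for $k = m-1$; this explains the correction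
in `duhamelJet`. -/
lemma duhamelJet_mem (hT : 0 < T) (hS : 0 < S.natDegree) (hg : IsFundamental S g)
    (hh : IntegrableOn h (Icc (-T) T)) : duhamelJet S g T h ∈ ACJet T S.natDegree := by
  have hle : -T ≤ T := by linarith
  have hI : uIcc (-T) T = Icc (-T) T := uIcc_of_le hle
  have hl : -T ∈ Icc (-T) T := left_mem_Icc.2 hle
  set Y : ℕ → ℝ → ℝ := fun j t => ∫ s in (-T)..t, g j (0 - s) * h s with hY
  have hint : ∀ j, ∀ t ∈ Icc (-T) T,
      IntervalIntegrable (fun s => g j (0 - s) * h s) volume (-T) t := fun j t ht =>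
    intervalIntegrable_mul hh (continuous_comp_const_sub hg.mem j 0) hl ht
  have hsep : ∀ k, ∀ t ∈ Icc (-T) T, ∫ s in (-T)..t, g k (t - s) * h s
      = ∑ j ∈ Finset.range S.natDegree, kernel S g j k t * Y j t := by
    intro k t ht
    simp only [apply_sub_eq_sum hS hg k, Finset.sum_mul, mul_assoc]
    rw [intervalIntegral.integral_finsetSum fun j _ => (hint j t ht).const_mul _]
    simp only [intervalIntegral.integral_const_mul, hY]
  have hw : ∀ j, kernel S g j ∈ Sol S := kernel_mem hg.mem
  have hYd : ∀ᵐ t ∂(volume.restrict (Icc (-T) T)), ∀ j, HasDerivAt (Y j) (g j (0 - t) * h t) t := by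
    rw [ae_all_iff]
    intro j
    rw [ae_restrict_iff' measurableSet_Icc]
    filter_upwards [(hint j T (right_mem_Icc.2 hle)).ae_hasDerivAt_integral] with t ht hmem
    exact ht (hI ▸ hmem) (-T) (by simp)
  intro k hk
  have hk0 : duhamelJet S g T h k = fun t => ∫ s in (-T)..t, g k (t - s) * h s := by
    funext t
    rw [duhamelJet, if_neg hk.ne, add_zero]
  constructor
  · refine AbsolutelyContinuousOnInterval.congr
      (f := fun t => ∑ j ∈ Finset.range S.natDegree, kernel S g j k t * Y j t) ?_ ?_
    · exact AbsolutelyContinuousOnInterval.finsetSum _ fun j _ =>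
        (Sol.mem_ACJet (hw j) T (k + 1) k (by omega)).1.fun_mul
          ((hint j T (right_mem_Icc.2 hle)).absolutelyContinuousOnInterval_intervalIntegral
            (by simp))
    · intro t ht
      rw [hk0, ← hsep k t (hI ▸ ht)]
  · filter_upwards [ae_restrict_Icc_mem_nhds (-T) T, hYd] with t hn hd
    have h1 : HasDerivAt (fun t => ∑ j ∈ Finset.range S.natDegree, kernel S g j k t * Y j t)
        (∑ j ∈ Finset.range S.natDegree,
          (kernel S g j (k + 1) t * Y j t + kernel S g j k t * (g j (0 - t) * h t))) t :=
      HasDerivAt.fun_sum fun j _ => ((hw j).1 k t).mul (hd j)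
    have e : duhamelJet S g T h (k + 1) t = ∑ j ∈ Finset.range S.natDegree,
          (kernel S g j (k + 1) t * Y j t + kernel S g j k t * (g j (0 - t) * h t)) := by
      have e1 := apply_sub_eq_sum hS hg k t t
      rw [Finset.sum_add_distrib, ← hsep _ t (mem_of_mem_nhds hn)]
      simp only [← mul_assoc]
      rw [← Finset.sum_mul, ← e1, sub_self, duhamelJet]
      congr 1
      split_ifs with hkm
      · rw [hg.top k hkm]; ring
      · rw [hg.low k (by omega), zero_mul]
    rw [e, hk0]
    refine h1.congr_of_eventuallyEq ?_
    filter_upwards [hn] with x hx using hsep k x hx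

/-- Under the integral $Sg = 0$, so only the correction at index $m$, multiplied by $c_m$, survives.
The equation thus holds at every point of the interval. -/
lemma aeval_duhamelJet (hT : 0 < T) (hS : 0 < S.natDegree) (hg : g ∈ Sol S)
    (hh : IntegrableOn h (Icc (-T) T)) (ht : t ∈ Icc (-T) T) :
    Polynomial.aeval shift S (duhamelJet S g T h) 0 t = h t := by
  have hc : S.leadingCoeff ≠ 0 := by
    rw [Polynomial.leadingCoeff_ne_zero]; rintro rfl; simp at hS
  have hl : -T ∈ Icc (-T) T := left_mem_Icc.2 (by linarith)
  have h1 : ∑ i ∈ Finset.range (S.natDegree + 1),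
      S.coeff i * ∫ s in (-T)..t, g (0 + i) (t - s) * h s = 0 := by
    simp only [← intervalIntegral.integral_const_mul]
    rw [← intervalIntegral.integral_finsetSum fun j _ =>
      (intervalIntegrable_mul hh (continuous_comp_const_sub hg _ t) hl ht).const_mul _]
    rw [intervalIntegral.integral_congr (g := fun _ => 0) fun s _ => ?_]
    · simp
    · have := congrFun (congrFun hg.2 0) (t - s)
      rw [aeval_apply_of_le le_rfl] at this
      simp only [← mul_assoc, ← Finset.sum_mul]
      rw [this]
      simp
  rw [aeval_apply_of_le le_rfl]
  simp only [duhamelJet, mul_add, Finset.sum_add_distrib, h1]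
  simp only [zero_add, mul_ite, mul_zero, Finset.sum_ite_eq', Finset.mem_range]
  rw [if_pos (by omega)]
  exact mul_div_cancel₀ _ hc

variable {ι : Type} [Fintype ι] {Λ : ι → Jet →ₗ[ℝ] ℝ} {v : ι → Jet}

lemma greenSolJet_mem (hT : 0 < T) (hS : 0 < S.natDegree) (hg : IsFundamental S g)
    (hv : ∀ i, v i ∈ Sol S) (hh : IntegrableOn h (Icc (-T) T)) :
    greenSolJet S g Λ v T h ∈ ACJet T S.natDegree :=
  Submodule.sub_mem _ (duhamelJet_mem hT hS hg hh) (Sol.mem_ACJet (sum_smul_mem hv _) T _)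

lemma aeval_greenSolJet (hT : 0 < T) (hS : 0 < S.natDegree) (hg : g ∈ Sol S)
    (hv : ∀ i, v i ∈ Sol S) (hh : IntegrableOn h (Icc (-T) T)) (ht : t ∈ Icc (-T) T) :
    Polynomial.aeval shift S (greenSolJet S g Λ v T h) 0 t = h t := by
  rw [greenSolJet, map_sub, (sum_smul_mem hv _).2, sub_zero, aeval_duhamelJet hT hS hg hh ht]

lemma twoPoint_duhamelJet (hT : 0 < T) (hg : g ∈ Sol S)
    (hh : IntegrableOn h (Icc (-T) T)) {l : Jet →ₗ[ℝ] ℝ} (hl : l ∈ TwoPoint T S.natDegree) :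
    l (duhamelJet S g T h) = ∫ s in (-T)..T, l (halfJet g s) * h s := by
  obtain ⟨A, B, hAB⟩ := TwoPoint.exists_coeff hl
  have h1 : ∀ s k, halfJet g s k (-T) = 0 := fun s k => if_neg (by linarith)
  have h2 : ∀ s k, halfJet g s k T = g k (T - s) := fun s k => if_pos hT
  simp only [hAB, h1, h2, mul_zero, zero_add, Finset.sum_mul, mul_assoc]
  rw [intervalIntegral.integral_finsetSum fun j _ =>
    (intervalIntegrable_mul hh (continuous_comp_const_sub hg _ T) (left_mem_Icc.2 (by linarith))
      (right_mem_Icc.2 (by linarith))).const_mul _]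
  refine Finset.sum_congr rfl fun k hk => ?_
  have hk' := (Finset.mem_range.1 hk).ne
  simp [duhamelJet, hk']

lemma twoPoint_greenSolJet [DecidableEq ι] (hT : 0 < T) (hg : g ∈ Sol S)
    (hΛ : ∀ i, Λ i ∈ TwoPoint T S.natDegree) (hΛv : ∀ i j, Λ i (v j) = if i = j then 1 else 0)
    (hh : IntegrableOn h (Icc (-T) T)) (i : ι) : Λ i (greenSolJet S g Λ v T h) = 0 := by
  rw [greenSolJet, map_sub, map_sum, twoPoint_duhamelJet hT hg hh (hΛ i)]
  simp [hΛv]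

/-- The bound $k < m$ excludes the index at which the solution jet contains the extra term $h/c_m$.
-/
lemma integral_greenJet (hT : 0 < T) (hg : g ∈ Sol S)
    (hΛ : ∀ i, Λ i ∈ TwoPoint T S.natDegree) (hh : IntegrableOn h (Icc (-T) T))
    (hk : k < S.natDegree) (ht : t ∈ Icc (-T) T) :
    IntervalIntegrable (fun s => greenJet g Λ v s k t * h s) volume (-T) T ∧
    ∫ s in (-T)..T, greenJet g Λ v s k t * h s = greenSolJet S g Λ v T h k t := by
  have hle : -T ≤ T := by linarith
  have hl : -T ∈ Icc (-T) T := left_mem_Icc.2 hle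
  have hr : T ∈ Icc (-T) T := right_mem_Icc.2 hle
  have hind : (fun s => stepJet g s k t * h s)
      = (Iio t).indicator fun s => g k (t - s) * h s := by
    funext s
    by_cases hs : s < t
    · rw [indicator_of_mem (mem_Iio.2 hs), stepJet_of_lt hs]
    · rw [indicator_of_notMem (by simpa using hs), stepJet_of_le (not_lt.1 hs), zero_mul]
  have i1 : IntervalIntegrable (fun s => stepJet g s k t * h s) volume (-T) T := by
    have := intervalIntegrable_mul hh (continuous_comp_const_sub hg k t) hl hr
    rw [intervalIntegrable_iff_integrableOn_Ioc_of_le hle] at this ⊢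
    rw [hind]
    exact this.indicator measurableSet_Iio
  have i2 : ∀ i, IntervalIntegrable (fun s => Λ i (halfJet g s) * h s) volume (-T) T := fun i =>
    intervalIntegrable_mul hh (continuous_halfJet hT hg (hΛ i)) hl hr
  have e1 : ∫ s in (-T)..T, stepJet g s k t * h s = duhamelJet S g T h k t := by
    rw [duhamelJet, if_neg hk.ne, add_zero, hind, intervalIntegral.integral_of_le hle,
      intervalIntegral.integral_of_le ht.1, setIntegral_indicator measurableSet_Iio,
      integral_Ioc_eq_integral_Ioo]
    congr 2
    ext s
    simp only [mem_inter_iff, mem_Ioc, mem_Iio, mem_Ioo]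
    exact ⟨fun hs => ⟨hs.1.1, hs.2⟩, fun hs => ⟨⟨hs.1, hs.2.le.trans ht.2⟩, hs.2⟩⟩
  have e : (fun s => greenJet g Λ v s k t * h s) = fun s => stepJet g s k t * h s
      - ∑ i, v i k t * (Λ i (halfJet g s) * h s) := by
    funext s
    rw [greenJet_apply, sub_mul, Finset.sum_mul]
    congr 1
    exact Finset.sum_congr rfl fun i _ => by ring
  have i3 : IntervalIntegrable (fun s => ∑ i, v i k t * (Λ i (halfJet g s) * h s))
      volume (-T) T := by
    have := IntervalIntegrable.sum Finset.univ fun i (_ : i ∈ Finset.univ) =>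
      (i2 i).const_mul (v i k t)
    simpa only [Finset.sum_fn] using this
  rw [e]
  refine ⟨i1.sub i3, ?_⟩
  rw [intervalIntegral.integral_sub i1 i3, e1,
    intervalIntegral.integral_finsetSum fun i _ => (i2 i).const_mul _]
  simp [greenSolJet, Finset.sum_apply, mul_comm]

lemma turnstile_eq (hT : 0 < T) (hg : g ∈ Sol S) (hv : ∀ i, v i ∈ Sol S) (R : ReflOp)
    (ht : t ∈ Icc (-T) T) (hs : s ≠ t) (hs' : s ≠ -t) :
    R.turnstile (Icc (-T) T) (fun t s => greenJet g Λ v s 0 t) t s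
      = op R (greenJet g Λ v s) 0 t := by
  have e := fun k => iteratedDerivWithin_eq (uniqueDiffOn_Icc (by linarith : -T < T))
    (isOpen_compl_singleton (x := s)) (N := k) (F := greenJet g Λ v s)
    (u := fun t => greenJet g Λ v s 0 t)
    (fun j _ x hx => (greenJet_hasDerivAt_of_ne hg hv hx.2 j).hasDerivWithinAt)
    (fun _ _ => rfl) k le_rfl
  exact act_eq (le_max_left _ _) (le_max_right _ _) (fun k _ => e k t ⟨ht, hs.symm⟩)
    fun k _ => e k (-t) ⟨neg_mem_Icc_neg ht, hs'.symm⟩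

lemma integral_turnstile (hT : 0 < T) (hg : g ∈ Sol S) (hv : ∀ i, v i ∈ Sol S)
    (hΛ : ∀ i, Λ i ∈ TwoPoint T S.natDegree) {R : ReflOp} {n : ℕ} (h1 : R.refl.natDegree ≤ n)
    (h2 : R.plain.natDegree ≤ n) (hn : n < S.natDegree) (hh : IntegrableOn h (Icc (-T) T))
    (ht : t ∈ Icc (-T) T) :
    IntervalIntegrable (fun s => R.turnstile (Icc (-T) T) (fun t s => greenJet g Λ v s 0 t) t s
      * h s) volume (-T) T ∧
    ∫ s in (-T)..T, R.turnstile (Icc (-T) T) (fun t s => greenJet g Λ v s 0 t) t s * h s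
      = op R (greenSolJet S g Λ v T h) 0 t := by
  have hop : ∀ F : Jet, op R F 0 t = ∑ i ∈ Finset.range (n + 1),
      (R.refl.coeff i * F i (-t) + R.plain.coeff i * F i t) := by
    intro F
    rw [op_apply, aeval_apply_of_le h1, aeval_apply_of_le h2, Finset.sum_add_distrib]
    simp
  have hI := fun (k : ℕ) (hk : k ∈ Finset.range (n + 1)) (x : ℝ) (hx : x ∈ Icc (-T) T) =>
    integral_greenJet (v := v) hT hg hΛ hh (by have := Finset.mem_range.1 hk; omega : k < _) hx
  have ht' := neg_mem_Icc_neg ht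
  -- At $s = \pm t$ the derivatives of $G(\cdot,s)$ taken by `R` may fail to exist; these two values
  -- of $s$ form a null set.
  have hae : (fun s => R.turnstile (Icc (-T) T) (fun t s => greenJet g Λ v s 0 t) t s * h s)
      =ᵐ[volume] fun s => ∑ i ∈ Finset.range (n + 1),
        (R.refl.coeff i * (greenJet g Λ v s i (-t) * h s)
          + R.plain.coeff i * (greenJet g Λ v s i t * h s)) := by
    have e1 : ∀ᵐ s : ℝ, s ≠ t := by simp [ae_iff, measure_singleton]
    have e2 : ∀ᵐ s : ℝ, s ≠ -t := by simp [ae_iff, measure_singleton]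
    filter_upwards [e1, e2] with s hs hs'
    rw [turnstile_eq hT hg hv R ht hs hs', hop, Finset.sum_mul]
    exact Finset.sum_congr rfl fun i _ => by ring
  have hint : ∀ i ∈ Finset.range (n + 1), IntervalIntegrable (fun s =>
      R.refl.coeff i * (greenJet g Λ v s i (-t) * h s)
          + R.plain.coeff i * (greenJet g Λ v s i t * h s)) volume (-T) T := fun i hi =>
    ((hI i hi _ ht').1.const_mul _).add ((hI i hi _ ht).1.const_mul _)
  constructor
  · have := IntervalIntegrable.sum (Finset.range (n + 1)) hint
    refine IntervalIntegrable.congr_ae (f := fun s => ∑ i ∈ Finset.range (n + 1),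
        (R.refl.coeff i * (greenJet g Λ v s i (-t) * h s)
          + R.plain.coeff i * (greenJet g Λ v s i t * h s)))
      (by simpa only [Finset.sum_fn] using this) (ae_restrict_of_ae hae.symm)
  · rw [intervalIntegral.integral_congr_ae (hae.mono fun _ hx _ => hx),
      intervalIntegral.integral_finsetSum hint, hop]
    refine Finset.sum_congr rfl fun i hi => ?_
    rw [intervalIntegral.integral_add ((hI i hi _ ht').1.const_mul _)
      ((hI i hi _ ht).1.const_mul _), intervalIntegral.integral_const_mul,
      intervalIntegral.integral_const_mul, (hI i hi _ ht').2, (hI i hi _ ht).2]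

end Jet

/-! ### The reducing operator -/

namespace ReflOp

/-- The reducing operator of `L`. -/
noncomputable def reducer (L : ReflOp) : ReflOp where
  refl := L.refl
  plain := -L.plain.comp (-Polynomial.X)

/-- The reduced operator, `R L` with `R` the reducing operator of `L`. -/
noncomputable def reduced (L : ReflOp) : ℝ[X] :=
  L.refl.comp (-Polynomial.X) * L.refl - L.plain.comp (-Polynomial.X) * L.plain

lemma coeff_comp_neg_X (P : ℝ[X]) (k : ℕ) :
    (P.comp (-Polynomial.X)).coeff k = (-1) ^ k * P.coeff k := by
  have : (-Polynomial.X : ℝ[X]) = Polynomial.C (-1) * Polynomial.X := by simp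
  rw [this, Polynomial.comp_C_mul_X_coeff, mul_comm]

lemma natDegree_comp_neg_X (P : ℝ[X]) : (P.comp (-Polynomial.X)).natDegree = P.natDegree := by
  simp [Polynomial.natDegree_comp]

lemma reducer_mul (L : ReflOp) : L.reducer * L = ofPoly L.reduced := by
  refine ReflOp.ext ?_ ?_
  · change L.refl * L.plain
      + (-L.plain.comp (-Polynomial.X)).comp (-Polynomial.X) * L.refl = 0
    rw [Polynomial.neg_comp, Polynomial.comp_neg_X_comp_neg_X]
    ring
  · change L.refl.comp (-Polynomial.X) * L.refl + -L.plain.comp (-Polynomial.X) * L.plain = _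
    rw [neg_mul, ← sub_eq_add_neg]
    rfl

/-- `R` and `L` commute although the algebra does not. This order of the product is what makes $Ry$
a solution of the original equation. -/
lemma mul_reducer (L : ReflOp) : L * L.reducer = ofPoly L.reduced := by
  refine ReflOp.ext ?_ ?_
  · change L.refl * -L.plain.comp (-Polynomial.X)
      + L.plain.comp (-Polynomial.X) * L.refl = 0
    ring
  · change L.refl.comp (-Polynomial.X) * L.refl + L.plain * -L.plain.comp (-Polynomial.X) = _
    rw [mul_neg, ← sub_eq_add_neg, mul_comm L.plain]
    rfl

/-- The coefficient of $S$ at $2n$ is $(-1)^n(a_n^2 - b_n^2)$. -/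
lemma coeff_sq_sub_ne_zero {L : ReflOp} {n : ℕ} (hn : 1 ≤ n) (h1 : L.refl.natDegree ≤ n)
    (h2 : L.plain.natDegree ≤ n) (hS : L.reduced.natDegree = 2 * n) :
    L.plain.coeff n ^ 2 - L.refl.coeff n ^ 2 ≠ 0 := by
  intro h
  have h0 : L.reduced ≠ 0 := by
    intro h0; rw [h0, Polynomial.natDegree_zero] at hS; omega
  apply Polynomial.leadingCoeff_ne_zero.2 h0
  rw [Polynomial.leadingCoeff, hS, reduced, Polynomial.coeff_sub, two_mul,
    Polynomial.coeff_mul_add_eq_of_natDegree_le ((natDegree_comp_neg_X _).trans_le h1) h1,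
    Polynomial.coeff_mul_add_eq_of_natDegree_le ((natDegree_comp_neg_X _).trans_le h2) h2,
    coeff_comp_neg_X, coeff_comp_neg_X]
  linear_combination (-(-1) ^ n) * h

end ReflOp

/-! ### Triviality of the homogeneous problem for $L$ -/

namespace Jet

variable {L : ReflOp} {T : ℝ} {n : ℕ} {α β : Fin n → Fin n → ℝ}

/-- Triviality of the homogeneous problem, in terms of jets. -/
lemma eq_zero_of_functionals {ι : Type} {S : ℝ[X]} {m : ℕ} (hT : 0 < T) (hm : 0 < m)
    (hS : S.natDegree = m)
    {C : ι → (ℝ → ℝ) → ℝ} {Λ : ι → Jet →ₗ[ℝ] ℝ} (hC : Represents T m C Λ)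
    (htriv : ∀ u : ℝ → ℝ, IsSolution T m (ReflOp.ofPoly S) C (fun _ => 0) u →
      ∀ t ∈ Icc (-T) T, u t = 0) {F : Jet} (hF : F ∈ Sol S) (h0 : ∀ i, Λ i F = 0) : F = 0 := by
  have hI : UniqueDiffOn ℝ (Icc (-T) T) := uniqueDiffOn_Icc (by linarith)
  have e := fun k => iteratedDerivWithin_eq hI isOpen_univ (N := k) (F := F) (u := F 0)
    (fun j _ x _ => Sol.derivAt hF _ j x) (fun _ _ => rfl) k le_rfl
  refine Sol.eq_zero_of_Icc (by omega) hF (by linarith : -T < T) (htriv (F 0) ⟨?_, ?_, fun i => ?_⟩)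
  · exact ACJet.isSobolev hT (Sol.mem_ACJet hF T m) fun _ _ => rfl
  · filter_upwards [ae_restrict_mem measurableSet_Icc] with t ht
    rw [act_eq (n := m) (F := F) (by simp [ReflOp.ofPoly]) (by simp [ReflOp.ofPoly, hS])
      (fun k _ => e k t ⟨ht, mem_univ _⟩) (fun k _ => e k (-t) ⟨neg_mem_Icc_neg ht, mem_univ _⟩),
      op_ofPoly, hF.2]
    rfl
  · rw [hC univ isOpen_univ (fun _ _ => mem_univ _) (mem_univ _) (F 0) F
      (fun k _ t _ => Sol.derivAt hF _ k t) (fun _ _ => rfl) i, h0 i]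

/-- The homogeneous problem `L u = 0`, `B_i u = 0` has only the trivial solution. -/
theorem eq_zero_of_bdryJet (hT : 0 < T) (hn : 1 ≤ n) (h1 : L.refl.natDegree ≤ n)
    (h2 : L.plain.natDegree ≤ n) (hS : L.reduced.natDegree = 2 * n)
    {v : Fin n ⊕ Fin n → Jet} (hv : ∀ i, v i ∈ Sol L.reduced)
    (hΛv : ∀ i j, reducedJet T α β L.reducer i (v j) = if i = j then 1 else 0)
    {d : Jet} (hd : d ∈ ACJet T n)
    (hLd : ∀ᵐ t ∂(volume.restrict (Icc (-T) T)), op L d 0 t = 0)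
    (hBd : ∀ i, bdryJet T α β i d = 0) : ∀ t ∈ Icc (-T) T, d 0 t = 0 := by
  have hR1 : L.reducer.refl.natDegree ≤ n := h1
  have hR2 : L.reducer.plain.natDegree ≤ n := by
    change (-L.plain.comp (-Polynomial.X)).natDegree ≤ n
    rw [Polynomial.natDegree_neg, ReflOp.natDegree_comp_neg_X]
    exact h2
  have hne := ReflOp.coeff_sq_sub_ne_zero hn h1 h2 hS
  have hB : ∀ i, bdryJet T α β i ∈ TwoPoint T n := fun i =>
    Submodule.sum_mem _ fun j _ => Submodule.add_mem _
      (Submodule.smul_mem _ _ (TwoPoint.evalAt_mem j.2 (Or.inl rfl)))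
      (Submodule.smul_mem _ _ (TwoPoint.evalAt_mem j.2 (Or.inr rfl)))
  -- `z x` is $R$ applied to a combination of the solutions dual to the functionals $B_iR$: it lies
  -- in $\ker L$ by $LR = S$, and its boundary values are exactly `x`.
  let z : (Fin n → ℝ) →ₗ[ℝ] Jet :=
    op L.reducer ∘ₗ (Fintype.linearCombination ℝ fun i : Fin n => v (Sum.inl i))
  have hz : ∀ x, z x = op L.reducer (∑ i, x i • v (Sum.inl i)) := fun x => by
    simp [z, Fintype.linearCombination_apply]
  have hzac : ∀ x, z x ∈ ACJet T n := fun x => by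
    rw [hz]
    exact ACJet.op_mem hT hR1 hR2 (Sol.mem_ACJet (sum_smul_mem (fun i => hv _) x) T (n + n))
  have hLz : ∀ x, op L (z x) = 0 := fun x => by
    rw [hz, ← Module.End.mul_apply, ← op_mul, ReflOp.mul_reducer, op_ofPoly]
    exact (sum_smul_mem (fun i => hv _) x).2
  have hBz : ∀ x i, bdryJet T α β i (z x) = x i := fun x i => by
    rw [hz]
    change reducedJet T α β L.reducer (Sum.inl i) _ = _
    rw [map_sum]
    simp [hΛv]
  let f : (Fin n → ℝ) →ₗ[ℝ] (Fin n → ℝ) := LinearMap.pi fun k : Fin n => evalAt k 0 ∘ₗ z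
  have hzero : ∀ F ∈ ACJet T n, (∀ᵐ t ∂(volume.restrict (Icc (-T) T)), op L F 0 t = 0) →
      (∀ k < n, F k 0 = 0) → ∀ i, bdryJet T α β i F = 0 := by
    intro F hF hLF h0 i
    have := ACJet.eq_zero_of_data hT h1 h2 hne hF hLF h0
    rw [TwoPoint.congr (hB i) (G := 0) fun k hk => ⟨this k hk _ (left_mem_Icc.2 (by linarith)),
      this k hk _ (right_mem_Icc.2 (by linarith))⟩, map_zero]
  -- If `z x` has zero data at $0$, it vanishes on the interval, hence so do its boundary values
  -- `x`. Equality of dimensions then makes `f` surjective.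
  have hinj : Function.Injective f := by
    rw [injective_iff_map_eq_zero]
    intro x hx
    funext i
    rw [← hBz x i]
    exact hzero _ (hzac x) (Eventually.of_forall fun t => by rw [hLz]; rfl)
      (fun k hk => congrFun hx ⟨k, hk⟩) i
  obtain ⟨x, hx⟩ := LinearMap.injective_iff_surjective.1 hinj fun k => d k 0
  have hdz := Submodule.sub_mem _ hd (hzac x)
  have hLdz : ∀ᵐ t ∂(volume.restrict (Icc (-T) T)), op L (d - z x) 0 t = 0 := by
    filter_upwards [hLd] with t ht
    rw [map_sub, hLz, sub_zero, ht]
  have hdata : ∀ k < n, (d - z x) k 0 = 0 := fun k hk => by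
    have : z x k 0 = d k 0 := congrFun hx ⟨k, hk⟩
    change d k 0 - z x k 0 = 0
    rw [this, sub_self]
  -- With matching data at $0$, `d - z x` vanishes on the interval; its boundary values are $-x$,
  -- because those of `d` are zero.
  have hx0 : x = 0 := by
    funext i
    have := hzero _ hdz hLdz hdata i
    rw [map_sub, hBd, hBz, zero_sub, neg_eq_zero] at this
    exact this
  intro t ht
  have := ACJet.eq_zero_of_data hT h1 h2 hne hdz hLdz hdata 0 (by omega) t ht
  rwa [hx0, map_zero, sub_zero] at this

end Jet

end ReflectionBVP

/-! ### Proof of the theorem -/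

open ReflectionBVP ReflectionBVP.Jet

theorem theorem3p2 (L : ReflectionBVP.ReflOp) :
    ∃ (R : ReflectionBVP.ReflOp) (S : ℝ[X]),
      (∀ k : ℕ, R.refl.coeff k = L.refl.coeff k) ∧
      (∀ l : ℕ, R.plain.coeff l = (-1 : ℝ) ^ (l + 1) * L.plain.coeff l) ∧
      R * L = ReflectionBVP.ReflOp.ofPoly S ∧
      ∀ (T : ℝ), 0 < T → ∀ (n : ℕ), 1 ≤ n →
      -- `L` has order at most `n`, and the reduced problem, with its `2n` conditions, order `2n`
      L.refl.natDegree ≤ n → L.plain.natDegree ≤ n → S.natDegree = 2 * n →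
      ∀ (α β : Fin n → Fin n → ℝ),
      -- the reduced homogeneous problem has only the trivial solution
      (∀ u : ℝ → ℝ,
        ReflectionBVP.IsSolution T (2 * n) (ReflectionBVP.ReflOp.ofPoly S)
          (ReflectionBVP.reducedBdry T α β R) (fun _ => 0) u →
        ∀ t ∈ Icc (-T) T, u t = 0) →
      ∃ G : ℝ → ℝ → ℝ,
        -- `G` is the unique Green's function of the reduced problem
        ReflectionBVP.IsGreen T S (ReflectionBVP.reducedBdry T α β R) G ∧
        (∀ G' : ℝ → ℝ → ℝ,
          ReflectionBVP.IsGreen T S (ReflectionBVP.reducedBdry T α β R) G' →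
          ∀ t ∈ Icc (-T) T, ∀ s ∈ Icc (-T) T, G' t s = G t s) ∧
        ∀ h : ℝ → ℝ, IntegrableOn h (Icc (-T) T) →
          -- the integral makes sense, and it is the unique solution of the original problem
          (∀ t ∈ Icc (-T) T,
            IntervalIntegrable (fun s => R.turnstile (Icc (-T) T) G t s * h s) volume (-T) T) ∧
          ReflectionBVP.IsSolution T n L (ReflectionBVP.bdry T α β) h
            (fun t => ∫ s in (-T)..T, R.turnstile (Icc (-T) T) G t s * h s) ∧
          ∀ w : ℝ → ℝ, ReflectionBVP.IsSolution T n L (ReflectionBVP.bdry T α β) h w →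
            ∀ t ∈ Icc (-T) T, w t = ∫ s in (-T)..T, R.turnstile (Icc (-T) T) G t s * h s := by
  refine ⟨L.reducer, L.reduced, fun _ => rfl, fun l => ?_, L.reducer_mul, ?_⟩
  · change (-L.plain.comp (-Polynomial.X)).coeff l = _
    rw [Polynomial.coeff_neg, ReflOp.coeff_comp_neg_X, pow_succ]
    ring
  intro T hT n hn h1 h2 hS α β htriv
  have hR1 : L.reducer.refl.natDegree ≤ n := h1
  have hR2 : L.reducer.plain.natDegree ≤ n := by
    change (-L.plain.comp (-Polynomial.X)).natDegree ≤ n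
    rw [Polynomial.natDegree_neg, ReflOp.natDegree_comp_neg_X]
    exact h2
  have hC := represents_reducedBdry hT α β hR1 hR2
  have hΛ := reducedJet_mem (T := T) α β hR1 hR2
  have htriv' : ∀ F ∈ Sol L.reduced, (∀ i, reducedJet T α β L.reducer i F = 0) → F = 0 :=
    fun F hF => eq_zero_of_functionals hT (by omega) hS hC htriv hF
  rw [← hS] at hC hΛ
  have hS0 : 0 < L.reduced.natDegree := by omega
  obtain ⟨g, hg⟩ := exists_isFundamental hS0
  obtain ⟨v, hv, hΛv⟩ := Sol.exists_dual_basis hS0 (ι := Fin n ⊕ Fin n)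
    (by rw [hS, Fintype.card_sum, Fintype.card_fin, two_mul]) _ htriv'
  set Λ := reducedJet T α β L.reducer with hΛdef
  refine ⟨fun t s => greenJet g Λ v s 0 t, isGreen_greenJet hT hg hΛ hv hΛv hC,
    fun G' hG' t ht s hs => eq_greenJet hT (by omega) hg hΛ hv hΛv htriv' hC hG' ht hs,
    fun h hh => ?_⟩
  have hint := fun (t : ℝ) (ht : t ∈ Icc (-T) T) =>
    integral_turnstile hT hg.mem hv hΛ hR1 hR2 (by omega) hh ht
  set F := op L.reducer (greenSolJet L.reduced g Λ v T h) with hF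
  have hFac : F ∈ ACJet T n := by
    refine ACJet.op_mem hT hR1 hR2 ?_
    have := greenSolJet_mem (Λ := Λ) hT hS0 hg hv hh
    rwa [hS, two_mul] at this
  have hFeq : ∀ t ∈ Icc (-T) T, op L F 0 t = h t := fun t ht => by
    rw [hF, ← Module.End.mul_apply, ← op_mul, ReflOp.mul_reducer, op_ofPoly,
      aeval_greenSolJet hT hS0 hg.mem hv hh ht]
  -- The functionals indexed by `Sum.inl` are the $B_iR$, so these are conditions on the solution of
  -- the reduced problem.
  have hFB : ∀ i, bdryJet T α β i F = 0 := fun i =>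
    twoPoint_greenSolJet hT hg.mem hΛ hΛv hh (Sum.inl i)
  refine ⟨fun t ht => (hint t ht).1, ⟨ACJet.isSobolev hT hFac fun t ht => (hint t ht).2, ?_, ?_⟩, ?_⟩
  -- The $n$-th derivative is identified only almost everywhere, and `L` reads it at $t$ and at
  -- $-t$, so the exceptional set is also reflected.
  · have hae := ACJet.ae_iteratedDerivWithin_eq hT hFac fun t ht => (hint t ht).2
    filter_upwards [hae, ae_restrict_neg hae, ae_restrict_mem measurableSet_Icc] with t e e' ht
    rw [act_eq h1 h2 e e', hFeq t ht]
  · intro i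
    rw [bdry_eq hT α β univ isOpen_univ (fun _ _ => mem_univ _) (mem_univ _) _ F
      (fun k hk t ht => ACJet.derivAt hT hFac hk ht.1) (fun t ht => (hint t ht.1).2) i, hFB i]
  · intro w hw t ht
    have hWac := hw.regular.mem_ACJet hT
    set W : Jet := fun k => iteratedDerivWithin k w (Icc (-T) T) with hW
    have hLd : ∀ᵐ t ∂(volume.restrict (Icc (-T) T)), op L (W - F) 0 t = 0 := by
      filter_upwards [hw.equation, ae_restrict_mem measurableSet_Icc] with x hx hxI
      rw [act_eq h1 h2 (F := W) (fun _ _ => rfl) fun _ _ => rfl] at hx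
      rw [map_sub]
      change op L W 0 x - op L F 0 x = 0
      rw [hx, hFeq x hxI, sub_self]
    have hWB : ∀ i, bdryJet T α β i W = 0 := fun i => by
      rw [← hw.conditions i, bdry, bdryJet, LinearMap.sum_apply]
      rfl
    have := eq_zero_of_bdryJet hT hn h1 h2 hS hv hΛv (Submodule.sub_mem _ hWac hFac) hLd
      (fun i => by rw [map_sub, hWB, hFB, sub_zero]) t ht
    change iteratedDerivWithin 0 w (Icc (-T) T) t - F 0 t = 0 at this
    rw [iteratedDerivWithin_zero, sub_eq_zero] at this
    rw [this, (hint t ht).2]
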